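/- Let $A(t)$ and $B(t)$ ($t\in\mathbb{R}$) be real $n_1\times n_1$ and $n_2\times n_2$ matrices, locally integrable in $t$ and with $\sup_t|A(t)|\le\beta$, $\sup_t|B(t)|\le\beta$ for some constant $\beta$. Let $f:\mathbb{R}\times\mathbb{R}^{n_1}\to\mathbb{R}^{n_1}$, $g:\mathbb{R}\times\mathbb{R}^{n_1}\to\mathbb{R}^{n_2}$, $\phi:\mathbb{R}\times\mathbb{R}^{n_2}\to\mathbb{R}^{n_1}$, $\psi:\mathbb{R}\times\mathbb{R}^{n_2}\to\mathbb{R}^{n_2}$ be locally integrable in $t$ for each fixed value of the second variable. Here $|\cdot|$ denotes arbitrary fixed norms on $\mathbb{R}^{n_1}$ and $\mathbb{R}^{n_2}$, the norm $|(x,y)|=\max(|x|,|y|)$ on $\mathbb{R}^{n_1}\times\mathbb{R}^{n_2}$, and the induced matrix norms. Suppose there are constants $\lambda,\delta,\omega>0$ such that for all $t\in\mathbb{R}$, $x,x_1,x_2\in\mathbb{R}^{n_1}$ and $y,y_1,y_2\in\mathbb{R}^{n_2}$ $$|f(t,x)|\le\lambda|x|,\quad |g(t,x)|\le\lambda|x|,\quad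 |\phi(t,y)|\le\delta,\quad |\psi(t,y)|\le\delta,$$ $$|f(t,x_1)-f(t,x_2)|\le\omega|x_1-x_2|,\quad |g(t,x_1)-g(t,x_2)|\le\omega|x_1-x_2|,$$ $$|\phi(t,y_1)-\phi(t,y_2)|\le\omega|y_1-y_2|,\quad |\psi(t,y_1)-\psi(t,y_2)|\le\omega|y_1-y_2|.$$ Assume that the linear system $$x'=A(t)x,\qquad y'=B(t)y \qquad (1)$$ has an $\alpha$-exponential dichotomy on $\mathbb{R}$ with constants $K\ge1$ and $\alpha>0$: if $Z(t,s)$ is the transition matrix of (1) on $\mathbb{R}^{n_1}\times\mathbb{R}^{n_2}$, there is a projection $P$ with $|Z(t,0)PZ(0,s)|\le Ke^{-\alpha|t-s|}$ for $t\ge s$ and $|Z(t,0)(I-P)Z(0,s)|\le Ke^{-\alpha|t-s|}$ for $t<s$. If moreover $$8K\omega\alpha^{-1}<1,\qquad 8K\lambda\alpha^{-1}<1,$$ then the system $$x'=A(t)x+f(t,x)+\phi(t,y),\qquad y'=B(t)y+g(t,x)+\psi(t,y) \qquad (2)$$ is topologically conjugated to (1). That is, there are continuous maps $H,L:\mathbb{R}\times\mathbb{R}^{n_1+n_2}\to\mathbb{R}^{n_1+n_2}$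 such that for every $t$ the maps $H(t,\cdot)$ and $L(t,\cdot)$ are mutually inverse homeomorphisms of $\mathbb{R}^{n_1+n_2}$; $|H(t,z)|\to\infty$ and $|L(t,z)|\to\infty$ as $|z|\to\infty$, uniformly in $t$; $t\mapsto H(t,z(t))$ is a solution of (1) whenever $z(t)$ is a solution of (2); and $t\mapsto L(t,z(t))$ is a solution of (2) whenever $z(t)$ is a solution of (1). (Solutions are defined on $\mathbb{R}$, locally absolutely continuous, and satisfy the equation almost everywhere; they are the classical solutions when the coefficients are continuous.) -/

import Mathlib

open MeasureTheory

/-- `z : ℝ → E` is a solution on `ℝ` of the ordinary differential equation `z' = G(t, z)`, in the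
sense of Carathéodory (the right-hand side is only assumed locally integrable in time):
`t ↦ G(t, z(t))` is locally integrable and `z` is a primitive of it, that is, `z` is
locally absolutely continuous and satisfies the equation almost everywhere. If `G` is jointly
continuous, these are exactly the classical `C¹` solutions. -/
def IsSolution {E : Type*} [NormedAddCommGroup E] [NormedSpace ℝ E]
    (G : ℝ → E → E) (z : ℝ → E) : Prop :=
  LocallyIntegrable (fun s => G s (z s)) volume ∧
    ∀ a b : ℝ, z b - z a = ∫ s in a..b, G s (z s)

/-- `Z(t, s)` is the transition matrix of the linear system `z' = M(t) z`: for every `s`, the map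
`t ↦ Z(t, s)` solves the matrix equation `Z' = M(t) Z`, and `Z(s, s) = I`. -/
def IsTransitionMatrix {E : Type*} [NormedAddCommGroup E] [NormedSpace ℝ E]
    (M : ℝ → E →L[ℝ] E) (Z : ℝ → ℝ → E →L[ℝ] E) : Prop :=
  ∀ s : ℝ, IsSolution (fun t U => (M t).comp U) (fun t => Z t s) ∧
    Z s s = ContinuousLinearMap.id ℝ E

/-- The linear system `z' = M(t) z` has an exponential dichotomy on `ℝ` with constant `K` and
exponent `α`: its transition matrix `Z` satisfies, for some projection `P`,
`|Z(t,0) P Z(0,s)| ≤ K e^{-α|t-s|}` for `t ≥ s` and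
`|-Z(t,0) (I-P) Z(0,s)| ≤ K e^{-α|t-s|}` for `s > t`. -/
def HasExpDichotomy {E : Type*} [NormedAddCommGroup E] [NormedSpace ℝ E]
    (M : ℝ → E →L[ℝ] E) (K α : ℝ) : Prop :=
  ∃ (Z : ℝ → ℝ → E →L[ℝ] E) (P : E →L[ℝ] E),
    IsTransitionMatrix M Z ∧ P.comp P = P ∧
    (∀ t s : ℝ, s ≤ t →
      ‖((Z t 0).comp P).comp (Z 0 s)‖ ≤ K * Real.exp (-α * |t - s|)) ∧
    (∀ t s : ℝ, t < s →
      ‖-((Z t 0).comp (ContinuousLinearMap.id ℝ E - P)).comp (Z 0 s)‖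
        ≤ K * Real.exp (-α * |t - s|))

/-- `H : ℝ × E → E` is a topological equivalence from the system `z' = F(t, z)` to the system
`z' = G(t, z)`. -/
structure IsTopEquivalence {E : Type*} [NormedAddCommGroup E] [NormedSpace ℝ E]
    (F G : ℝ → E → E) (H : ℝ → E → E) : Prop where
  continuous : Continuous (fun p : ℝ × E => H p.1 p.2)
  homeomorph : ∀ t : ℝ, IsHomeomorph (H t)
  /-- `H(t, z) → ∞` as `z → ∞`, uniformly with respect to `t`. -/
  proper : ∀ R : ℝ, ∃ r : ℝ, ∀ (t : ℝ) (z : E), r ≤ ‖z‖ → R ≤ ‖H t z‖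
  maps_solutions : ∀ z : ℝ → E, IsSolution F z → IsSolution G (fun t => H t (z t))

/-- The systems `z' = F(t, z)` and `z' = G(t, z)` are topologically conjugated: there is a
topological equivalence `H` from the first to the second whose inverse `L(t, ·) = H(t, ·)⁻¹` is a
topological equivalence from the second to the first. -/
def TopologicallyConjugated {E : Type*} [NormedAddCommGroup E] [NormedSpace ℝ E]
    (F G : ℝ → E → E) : Prop :=
  ∃ H L : ℝ → E → E, IsTopEquivalence F G H ∧ IsTopEquivalence G F L ∧
    ∀ t : ℝ, Function.LeftInverse (L t) (H t) ∧ Function.RightInverse (L t) (H t)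

/-! Write (2) as z' = M(t)z + h(t,z) with M = diag(A, B). Then h is Lipschitz in z with constant L =
2ω and bounded along z = 0, and the smallness used throughout is 4KL < α. Since f and g grow
linearly, h need not be bounded, so the conjugacy is not sought as a bounded displacement of the
identity. It is built on solution curves, from the stable and unstable manifolds of the two systems.

Reduction: (2) has a bounded solution (`exists_bdd_lip`, a contraction). Translating by it makes h
vanish at 0, so that 0 solves both systems.

Product structure: any two solutions a, b of the perturbed system have a unique bracket, a solution
at bounded distance from a in the past and from b in the future (`exists_bracket`, `eq_of_bdd`).
Bracketing z with 0 gives its stable part, which is bounded in the future and follows z in the past.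
Reversing time gives the unstable part, and z is recovered as the bracket of its two parts.

Matching: for the seminorm `stableNorm`, adapted to the dichotomy, differences of solutions bounded
in the future lie in a cone and decay (`cone`). Hence the stable manifold is a graph over the range
of P(t), and a nonzero stable solution crosses the unit sphere of the seminorm exactly once. Stable
solutions of two systems are matched when they have the same projection at that crossing time; this
sphere is a fundamental domain.

Conjugacy: two solutions correspond when their stable parts match and, in reversed time, their
unstable parts match. The relation is symmetric, a bijection between solutions, and has bounds
uniform in time. Evaluating the partner of the solution through (t, x) at time t defines H(t, x).
Continuity follows from uniqueness and compactness of closed balls. The linear system is the case h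
= 0. -/

open Filter Topology Set

/-! ### Carathéodory equations: Grönwall, measurability, global existence, product rule. -/

section Caratheodory

set_option linter.unusedSectionVars false

variable {E : Type*} [NormedAddCommGroup E] [NormedSpace ℝ E]

/-- `z` is a primitive of the locally integrable function `k`. -/
def IsPrimitive (k z : ℝ → E) : Prop :=
  LocallyIntegrable k volume ∧ ∀ a b : ℝ, z b - z a = ∫ s in a..b, k s

/-- Boundedness on bounded intervals. -/
def LocBdd {V : Type*} [NormedAddCommGroup V] (k : ℝ → V) : Prop :=
  ∀ N : ℝ, ∃ C : ℝ, ∀ t, |t| ≤ N → ‖k t‖ ≤ C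

theorem Continuous.locBdd {V : Type*} [NormedAddCommGroup V] {k : ℝ → V} (hk : Continuous k) :
    LocBdd k := by
  intro N
  obtain ⟨C, hC⟩ := (isCompact_Icc (a := -N) (b := N)).exists_bound_of_continuousOn hk.continuousOn
  exact ⟨C, fun t ht => hC t (abs_le.mp ht)⟩

theorem LocBdd.locallyIntegrable {V : Type*} [NormedAddCommGroup V] {k : ℝ → V} (hk : LocBdd k)
    (hm : AEStronglyMeasurable k volume) : LocallyIntegrable k volume := by
  rw [locallyIntegrable_iff]
  intro S hS
  obtain ⟨N, hN⟩ := hS.isBounded.exists_norm_le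
  obtain ⟨C, hC⟩ := hk N
  refine IntegrableOn.of_bound hS.measure_lt_top hm.restrict C ?_
  exact (ae_restrict_iff' hS.measurableSet).mpr (Eventually.of_forall fun x hx => hC x (hN x hx))

theorem MeasureTheory.LocallyIntegrable.intervalIntegrable_real {V : Type*} [NormedAddCommGroup V]
    {k : ℝ → V} (hk : LocallyIntegrable k volume) (a b : ℝ) : IntervalIntegrable k volume a b :=
  (hk.integrableOn_isCompact isCompact_uIcc).intervalIntegrable

theorem MeasureTheory.LocallyIntegrable.comp_neg_real {V : Type*} [NormedAddCommGroup V]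
    {k : ℝ → V} (hk : LocallyIntegrable k volume) : LocallyIntegrable (fun t => k (-t)) volume := by
  rw [locallyIntegrable_iff] at hk ⊢
  intro S hS
  have h := hk (-S) hS.neg
  have e : MeasurableEmbedding (fun t : ℝ => -t) := (Homeomorph.neg ℝ).measurableEmbedding
  have h2 := ((Measure.measurePreserving_neg (volume : Measure ℝ)).integrableOn_comp_preimage e
    (f := k) (s := -S)).mpr h
  have h3 : (fun t : ℝ => -t) ⁻¹' (-S) = S := by ext t; simp
  rwa [h3] at h2

theorem IsPrimitive.continuous {k z : ℝ → E} (h : IsPrimitive k z) : Continuous z := by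
  have h1 := intervalIntegral.continuous_primitive h.1.intervalIntegrable_real 0
  have h2 : z = fun b => z 0 + ∫ s in (0 : ℝ)..b, k s := by
    funext b
    rw [← h.2]; abel
  rw [h2]
  exact continuous_const.add h1

theorem IsSolution.isPrimitive {F : ℝ → E → E} {z : ℝ → E} (h : IsSolution F z) :
    IsPrimitive (fun s => F s (z s)) z := h

theorem IsSolution.continuous {F : ℝ → E → E} {z : ℝ → E} (h : IsSolution F z) : Continuous z :=
  h.isPrimitive.continuous

theorem IsPrimitive.congr {k k' z : ℝ → E} (h : IsPrimitive k z) (hk : ∀ s, k s = k' s) :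
    IsPrimitive k' z := by
  rwa [← funext hk]

theorem IsPrimitive.add {k₁ k₂ z₁ z₂ : ℝ → E} (h₁ : IsPrimitive k₁ z₁) (h₂ : IsPrimitive k₂ z₂) :
    IsPrimitive (fun s => k₁ s + k₂ s) (fun s => z₁ s + z₂ s) := by
  refine ⟨h₁.1.add h₂.1, fun a b => ?_⟩
  rw [intervalIntegral.integral_add (h₁.1.intervalIntegrable_real a b)
    (h₂.1.intervalIntegrable_real a b), ← h₁.2, ← h₂.2]
  beta_reduce
  abel

theorem IsPrimitive.sub {k₁ k₂ z₁ z₂ : ℝ → E} (h₁ : IsPrimitive k₁ z₁) (h₂ : IsPrimitive k₂ z₂) :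
    IsPrimitive (fun s => k₁ s - k₂ s) (fun s => z₁ s - z₂ s) := by
  refine ⟨h₁.1.sub h₂.1, fun a b => ?_⟩
  rw [intervalIntegral.integral_sub (h₁.1.intervalIntegrable_real a b)
    (h₂.1.intervalIntegrable_real a b), ← h₁.2, ← h₂.2]
  beta_reduce
  abel

theorem IsPrimitive.comp_neg {k z : ℝ → E} (h : IsPrimitive k z) :
    IsPrimitive (fun s => -k (-s)) (fun s => z (-s)) := by
  refine ⟨h.1.comp_neg_real.neg, fun a b => ?_⟩
  rw [intervalIntegral.integral_neg, intervalIntegral.integral_comp_neg, h.2,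
    intervalIntegral.integral_symm]

theorem isPrimitive_primitive {k : ℝ → E} (hk : LocallyIntegrable k volume) (τ : ℝ) (x : E) :
    IsPrimitive k (fun t => x + ∫ s in τ..t, k s) := by
  refine ⟨hk, fun a b => ?_⟩
  rw [add_sub_add_left_eq_sub, intervalIntegral.integral_interval_sub_left
    (hk.intervalIntegrable_real _ _) (hk.intervalIntegrable_real _ _)]

theorem IsPrimitive.clm_apply_const {V : Type*} [NormedAddCommGroup V] [NormedSpace ℝ V]
    [CompleteSpace E] [CompleteSpace V] {k z : ℝ → E} (h : IsPrimitive k z) (T : E →L[ℝ] V) :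
    IsPrimitive (fun s => T (k s)) (fun s => T (z s)) := by
  refine ⟨?_, fun a b => ?_⟩
  · have := h.1
    rw [locallyIntegrable_iff] at this ⊢
    exact fun S hS => T.integrable_comp (this S hS)
  · rw [T.intervalIntegral_comp_comm (h.1.intervalIntegrable_real a b), ← h.2, map_sub]

/-- Grönwall's inequality for a primitive of an integrable function. -/
theorem IsPrimitive.gronwall {k d : ℝ → E} (h : IsPrimitive k d) {Λ s t : ℝ} (hΛ : 0 ≤ Λ)
    (hst : s ≤ t) (hk : ∀ r ∈ Ioc s t, ‖k r‖ ≤ Λ * ‖d r‖) :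
    ‖d t‖ ≤ ‖d s‖ * Real.exp (Λ * (t - s)) := by
  have hdc := h.continuous
  have hc : Continuous fun r => Λ * ‖d r‖ := by fun_prop
  -- The norm of `d` need not be differentiable; its integral majorant `G` is, so the differential
  -- form of Grönwall applies to `G`.
  set G : ℝ → ℝ := fun x => ‖d s‖ + ∫ r in s..x, Λ * ‖d r‖ with hG
  have hGd : ∀ x, HasDerivAt G (Λ * ‖d x‖) x := fun x =>
    (hc.integral_hasStrictDerivAt s x).hasDerivAt.const_add _
  have hle : ∀ x ∈ Icc s t, ‖d x‖ ≤ G x := by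
    intro x hx
    have h1 : d x = d s + ∫ r in s..x, k r := by rw [← h.2]; abel
    have h2 : ‖∫ r in s..x, k r‖ ≤ ∫ r in s..x, Λ * ‖d r‖ :=
      intervalIntegral.norm_integral_le_of_norm_le hx.1
        (Eventually.of_forall fun r hr => hk r ⟨hr.1, hr.2.trans hx.2⟩)
        (hc.intervalIntegrable _ _)
    rw [h1]
    exact (norm_add_le _ _).trans (by simpa [hG] using h2)
  have hGn : ∀ x ∈ Icc s t, 0 ≤ G x := fun x hx => (norm_nonneg _).trans (hle x hx)
  have key := norm_le_gronwallBound_of_norm_deriv_right_le (f := G) (f' := fun x => Λ * ‖d x‖)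
    (δ := ‖d s‖) (K := Λ) (ε := 0) (a := s) (b := t)
    (fun x _ => (hGd x).continuousAt.continuousWithinAt)
    (fun x _ => (hGd x).hasDerivWithinAt) (by simp [hG])
    (by
      intro x hx
      have h0 := hle x ⟨hx.1, hx.2.le⟩
      rw [Real.norm_of_nonneg (by positivity), Real.norm_of_nonneg (hGn x ⟨hx.1, hx.2.le⟩), add_zero]
      exact mul_le_mul_of_nonneg_left h0 hΛ) t ⟨hst, le_rfl⟩
  rw [gronwallBound_ε0, Real.norm_of_nonneg (hGn t ⟨hst, le_rfl⟩)] at key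
  exact (hle t ⟨hst, le_rfl⟩).trans key

theorem IsPrimitive.gronwall_abs {k d : ℝ → E} (h : IsPrimitive k d) {Λ : ℝ} (hΛ : 0 ≤ Λ)
    (hk : ∀ r, ‖k r‖ ≤ Λ * ‖d r‖) (s t : ℝ) :
    ‖d t‖ ≤ ‖d s‖ * Real.exp (Λ * |t - s|) := by
  rcases le_total s t with hst | hst
  · rw [abs_of_nonneg (sub_nonneg.mpr hst)]
    exact h.gronwall hΛ hst fun r _ => hk r
  · have := h.comp_neg.gronwall (s := -s) (t := -t) hΛ (neg_le_neg hst)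
      (fun r _ => by simpa using hk (-r))
    rw [abs_of_nonpos (sub_nonpos.mpr hst)]
    simpa [sub_eq_add_neg, add_comm] using this

/-- If `F(·, x)` is measurable for all `x` and `F(t, ·)` is continuous for all `t`, then
`t ↦ F(t, z(t))` is measurable for continuous `z`. -/
theorem aestronglyMeasurable_caratheodory_comp {F : ℝ → E → E}
    (hm : ∀ x, AEStronglyMeasurable (fun t => F t x) volume) (hc : ∀ t, Continuous (F t))
    {z : ℝ → E} (hz : Continuous z) : AEStronglyMeasurable (fun t => F t (z t)) volume := by
  -- Sampling time on a grid of mesh 1/(n+1): on each cell `z (g n t)` is constant, so measurability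
  -- in time for a fixed state suffices, and continuity in the state gives the pointwise limit.
  set g : ℕ → ℝ → ℝ := fun n t => (⌊((n : ℝ) + 1) * t⌋ : ℝ) / ((n : ℝ) + 1) with hg
  have hgt : ∀ t, Tendsto (fun n => g n t) atTop (𝓝 t) := by
    intro t
    rw [tendsto_iff_dist_tendsto_zero]
    refine squeeze_zero (fun _ => dist_nonneg) (fun n => ?_)
      (tendsto_one_div_add_atTop_nhds_zero_nat (𝕜 := ℝ))
    have hn : (0 : ℝ) < (n : ℝ) + 1 := by positivity
    have h1 := Int.floor_le (((n : ℝ) + 1) * t)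
    have h2 := (Int.lt_floor_add_one (((n : ℝ) + 1) * t)).le
    have h3 : g n t - t = ((⌊((n : ℝ) + 1) * t⌋ : ℝ) - ((n : ℝ) + 1) * t) / ((n : ℝ) + 1) := by
      simp only [hg]; field_simp
    rw [Real.dist_eq, h3, abs_div, abs_of_pos hn]
    refine div_le_div_of_nonneg_right ?_ hn.le
    rw [abs_le]; constructor <;> linarith
  refine aestronglyMeasurable_of_tendsto_ae atTop (f := fun n t => F t (z (g n t))) ?_
    (Eventually.of_forall fun t => ((hc t).tendsto _).comp ((hz.tendsto _).comp (hgt t)))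
  intro n
  have hU : (⋃ i : ℤ, {t : ℝ | ⌊((n : ℝ) + 1) * t⌋ = i}) = univ := by
    ext t; simp
  rw [← Measure.restrict_univ (μ := (volume : Measure ℝ)), ← hU, aestronglyMeasurable_iUnion_iff]
  intro i
  have hS : MeasurableSet {t : ℝ | ⌊((n : ℝ) + 1) * t⌋ = i} := by
    have : Measurable fun t : ℝ => ⌊((n : ℝ) + 1) * t⌋ := by fun_prop
    exact this (measurableSet_singleton i)
  refine (hm (z ((i : ℝ) / ((n : ℝ) + 1)))).restrict.congr ?_
  refine (ae_restrict_iff' hS).mpr (Eventually.of_forall fun t ht => ?_)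
  have ht' : ⌊((n : ℝ) + 1) * t⌋ = i := ht
  simp only [hg, ht']

/-- A Carathéodory field, Lipschitz in the state variable and bounded along the zero state. -/
structure IsLipField (F : ℝ → E → E) (Λ : ℝ) : Prop where
  meas : ∀ x, AEStronglyMeasurable (fun t => F t x) volume
  lip : ∀ t x y, ‖F t x - F t y‖ ≤ Λ * ‖x - y‖
  nonneg : 0 ≤ Λ
  bdd : ∃ C, ∀ t, ‖F t 0‖ ≤ C

theorem IsLipField.continuous {F : ℝ → E → E} {Λ : ℝ} (hF : IsLipField F Λ) (t : ℝ) :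
    Continuous (F t) := by
  refine (LipschitzWith.of_dist_le_mul (K := ⟨Λ, hF.nonneg⟩) fun x y => ?_).continuous
  rw [dist_eq_norm, dist_eq_norm]
  exact hF.lip t x y

theorem IsLipField.aestronglyMeasurable {F : ℝ → E → E} {Λ : ℝ} (hF : IsLipField F Λ) {z : ℝ → E}
    (hz : Continuous z) : AEStronglyMeasurable (fun t => F t (z t)) volume :=
  aestronglyMeasurable_caratheodory_comp hF.meas hF.continuous hz

theorem IsLipField.norm_le {F : ℝ → E → E} {Λ : ℝ} (hF : IsLipField F Λ) {C : ℝ}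
    (hC : ∀ t, ‖F t 0‖ ≤ C) (t : ℝ) (x : E) : ‖F t x‖ ≤ C + Λ * ‖x‖ := by
  have h1 := hF.lip t x 0
  rw [sub_zero] at h1
  have h2 : F t x = F t 0 + (F t x - F t 0) := by abel
  rw [h2]
  exact (norm_add_le _ _).trans (add_le_add (hC t) h1)

theorem IsLipField.locBdd {F : ℝ → E → E} {Λ : ℝ} (hF : IsLipField F Λ) {z : ℝ → E}
    (hz : LocBdd z) : LocBdd (fun t => F t (z t)) := by
  obtain ⟨C, hC⟩ := hF.bdd
  intro N
  obtain ⟨D, hD⟩ := hz N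
  refine ⟨C + Λ * D, fun t ht => (hF.norm_le hC t _).trans ?_⟩
  have := mul_le_mul_of_nonneg_left (hD t ht) hF.nonneg
  linarith

theorem IsLipField.locallyIntegrable {F : ℝ → E → E} {Λ : ℝ} (hF : IsLipField F Λ) {z : ℝ → E}
    (hz : Continuous z) : LocallyIntegrable (fun t => F t (z t)) volume :=
  (hF.locBdd hz.locBdd).locallyIntegrable (hF.aestronglyMeasurable hz)

theorem IsLipField.norm_sub_le {F : ℝ → E → E} {Λ : ℝ} (hF : IsLipField F Λ) {z₁ z₂ : ℝ → E}
    (h₁ : IsSolution F z₁) (h₂ : IsSolution F z₂) (s t : ℝ) :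
    ‖z₁ t - z₂ t‖ ≤ ‖z₁ s - z₂ s‖ * Real.exp (Λ * |t - s|) :=
  (h₁.isPrimitive.sub h₂.isPrimitive).gronwall_abs hF.nonneg (fun r => hF.lip r _ _) s t

theorem IsLipField.eq_of_eq {F : ℝ → E → E} {Λ : ℝ} (hF : IsLipField F Λ) {z₁ z₂ : ℝ → E}
    (h₁ : IsSolution F z₁) (h₂ : IsSolution F z₂) {s : ℝ} (h : z₁ s = z₂ s) : z₁ = z₂ := by
  funext t
  have := hF.norm_sub_le h₁ h₂ s t
  rw [h, sub_self, norm_zero, zero_mul] at this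
  exact sub_eq_zero.mp (norm_le_zero_iff.mp this)

/-- Integrating the weight e^{γ|s-τ|} gains a factor 1/γ. This makes the Picard operator a
contraction in a weighted sup norm on the whole line. -/
theorem norm_integral_le_exp_abs {k : ℝ → E} {A γ τ : ℝ} (hγ : 0 < γ)
    (hk : ∀ s, ‖k s‖ ≤ A * Real.exp (γ * |s - τ|)) (t : ℝ) :
    ‖∫ s in τ..t, k s‖ ≤ A / γ * Real.exp (γ * |t - τ|) := by
  have hA : 0 ≤ A := by simpa using (norm_nonneg _).trans (hk τ)
  have key : ∀ (k : ℝ → E) (τ t : ℝ), τ ≤ t → (∀ s, ‖k s‖ ≤ A * Real.exp (γ * |s - τ|)) →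
      ‖∫ s in τ..t, k s‖ ≤ A / γ * Real.exp (γ * (t - τ)) := by
    intro k τ t hτ hk
    have hc : Continuous fun s => A * Real.exp (γ * (s - τ)) := by fun_prop
    have h1 : ‖∫ s in τ..t, k s‖ ≤ ∫ s in τ..t, A * Real.exp (γ * (s - τ)) :=
      intervalIntegral.norm_integral_le_of_norm_le hτ
        (Eventually.of_forall fun r hr => by
          simpa [abs_of_nonneg (sub_nonneg.mpr hr.1.le)] using hk r) (hc.intervalIntegrable _ _)
    have h2 : ∫ s in τ..t, A * Real.exp (γ * (s - τ))
        = A / γ * Real.exp (γ * (t - τ)) - A / γ * Real.exp (γ * (τ - τ)) := by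
      refine intervalIntegral.integral_eq_sub_of_hasDerivAt
        (f := fun s => A / γ * Real.exp (γ * (s - τ))) (fun s _ => ?_) (hc.intervalIntegrable _ _)
      have := ((((hasDerivAt_id s).sub_const τ).const_mul γ).exp).const_mul (A / γ)
      have e1 : A / γ * (Real.exp (γ * (s - τ)) * (γ * 1)) = A * Real.exp (γ * (s - τ)) := by
        field_simp
      rw [← e1]
      exact this
    rw [h2] at h1
    have : 0 ≤ A / γ * Real.exp (γ * (τ - τ)) := by positivity
    linarith
  rcases le_total τ t with h | h
  · rw [abs_of_nonneg (sub_nonneg.mpr h)]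
    exact key k τ t h hk
  · have := key (fun s => k (-s)) (-τ) (-t) (neg_le_neg h) (fun s => by
      have h1 := hk (-s)
      rwa [show |-s - τ| = |s - -τ| by rw [← abs_neg]; congr 1; ring] at h1)
    rw [intervalIntegral.integral_comp_neg, neg_neg, neg_neg, intervalIntegral.integral_symm,
      norm_neg] at this
    rw [abs_of_nonpos (sub_nonpos.mpr h)]
    convert this using 4; ring

/-- Global existence for Carathéodory equations with Lipschitz right-hand side. -/
theorem IsLipField.exists_solution [CompleteSpace E] {F : ℝ → E → E} {Λ : ℝ}
    (hF : IsLipField F Λ) (τ : ℝ) (x : E) : ∃ z, IsSolution F z ∧ z τ = x := by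
  obtain ⟨C, hC⟩ := hF.bdd
  have hΛ := hF.nonneg
  have hC0 : 0 ≤ C := (norm_nonneg _).trans (hC 0)
  -- With this weight Λ/γ ≤ 1/2, the contraction constant below. The unknown is the rescaled curve y
  -- = e^{-γ|t-τ|} z, which is a bounded function.
  set γ : ℝ := 2 * Λ + 1 with hγdef
  have hγ : 0 < γ := by positivity
  let e : ℝ → ℝ := fun t => Real.exp (γ * |t - τ|)
  have he : Continuous e := by fun_prop
  have he1 : ∀ t, 1 ≤ e t := fun t => Real.one_le_exp (by positivity)
  have he0 : ∀ t, 0 < e t := fun t => Real.exp_pos _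
  have hcont : ∀ y : BoundedContinuousFunction ℝ E, Continuous fun s => e s • y s := fun y =>
    he.smul y.continuous
  have hint : ∀ y : BoundedContinuousFunction ℝ E,
      LocallyIntegrable (fun s => F s (e s • y s)) volume := fun y =>
    hF.locallyIntegrable (hcont y)
  have hFe : ∀ (y : BoundedContinuousFunction ℝ E) s,
      ‖F s (e s • y s)‖ ≤ (C + Λ * ‖y‖) * Real.exp (γ * |s - τ|) := by
    intro y s
    refine (hF.norm_le hC s _).trans ?_
    rw [norm_smul, Real.norm_of_nonneg (he0 s).le]
    have h1 : C ≤ C * e s := le_mul_of_one_le_right hC0 (he1 s)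
    have h2 : e s * ‖y s‖ ≤ e s * ‖y‖ := mul_le_mul_of_nonneg_left (y.norm_coe_le_norm s) (he0 s).le
    have h3 := mul_le_mul_of_nonneg_left h2 hΛ
    change _ ≤ (C + Λ * ‖y‖) * e s
    nlinarith
  let T : BoundedContinuousFunction ℝ E → BoundedContinuousFunction ℝ E := fun y =>
    BoundedContinuousFunction.ofNormedAddCommGroup
      (fun t => (e t)⁻¹ • (x + ∫ s in τ..t, F s (e s • y s)))
      ((he.inv₀ fun t => (he0 t).ne').smul
        (isPrimitive_primitive (hint y) τ x).continuous)
      (‖x‖ + (C + Λ * ‖y‖) / γ) (by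
        intro t
        rw [norm_smul, norm_inv, Real.norm_of_nonneg (he0 t).le, inv_mul_le_iff₀ (he0 t)]
        have h1 := norm_integral_le_exp_abs hγ (hFe y) t
        have h2 : ‖x‖ ≤ e t * ‖x‖ := le_mul_of_one_le_left (norm_nonneg _) (he1 t)
        have h3 := norm_add_le x (∫ s in τ..t, F s (e s • y s))
        change _ ≤ _ * e t at h1
        nlinarith)
  have hT : ∀ y t, T y t = (e t)⁻¹ • (x + ∫ s in τ..t, F s (e s • y s)) := fun _ _ => rfl
  have hlip : ContractingWith (1 / 2) T := by
    refine ⟨by norm_num, LipschitzWith.of_dist_le_mul fun y₁ y₂ => ?_⟩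
    rw [BoundedContinuousFunction.dist_le (by positivity)]
    intro t
    rw [dist_eq_norm, hT, hT, ← smul_sub, add_sub_add_left_eq_sub,
      ← intervalIntegral.integral_sub ((hint y₁).intervalIntegrable_real _ _)
        ((hint y₂).intervalIntegrable_real _ _), norm_smul, norm_inv,
      Real.norm_of_nonneg (he0 t).le, inv_mul_le_iff₀ (he0 t)]
    have h1 := norm_integral_le_exp_abs (k := fun s => F s (e s • y₁ s) - F s (e s • y₂ s))
      (A := Λ * dist y₁ y₂) (τ := τ) hγ (by
        intro s
        refine (hF.lip s _ _).trans ?_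
        rw [← smul_sub, norm_smul, Real.norm_of_nonneg (he0 s).le, mul_assoc]
        refine mul_le_mul_of_nonneg_left ?_ hΛ
        rw [mul_comm, ← dist_eq_norm]
        exact mul_le_mul_of_nonneg_right (y₁.dist_coe_le_dist s) (he0 s).le) t
    refine h1.trans ?_
    change _ * e t ≤ _
    rw [mul_comm (e t)]
    refine mul_le_mul_of_nonneg_right ?_ (he0 t).le
    rw [div_le_iff₀ hγ]
    have hd : 0 ≤ dist y₁ y₂ := dist_nonneg
    have : ((1 / 2 : NNReal) : ℝ) = 1 / 2 := by norm_num
    rw [this, hγdef]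
    nlinarith
  set y := ContractingWith.fixedPoint T hlip with hy
  have hfix : T y = y := hlip.fixedPoint_isFixedPt
  have hfix' : ∀ t, e t • y t = x + ∫ s in τ..t, F s (e s • y s) := by
    intro t
    have := hT y t
    rw [hfix] at this
    rw [this, smul_inv_smul₀ (he0 t).ne']
  refine ⟨fun t => e t • y t, ?_, ?_⟩
  · have := isPrimitive_primitive (hint y) τ x
    rw [← funext hfix'] at this
    exact this
  · simpa using hfix' τ

/-- The product rule for locally Lipschitz primitives. -/
theorem IsPrimitive.clm_apply [CompleteSpace E] {Y' Y : ℝ → E →L[ℝ] E} {w' w : ℝ → E}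
    (hY : IsPrimitive Y' Y) (hw : IsPrimitive w' w) (hY' : LocBdd Y') (hw' : LocBdd w') :
    IsPrimitive (fun r => Y' r (w r) + Y r (w' r)) (fun r => Y r (w r)) := by
  have hYc := hY.continuous
  have hwc := hw.continuous
  have hap : Continuous fun p : (E →L[ℝ] E) × E => p.1 p.2 := isBoundedBilinearMap_apply.continuous
  have hmeas : ∀ {f : ℝ → E →L[ℝ] E} {g : ℝ → E}, AEStronglyMeasurable f volume →
      AEStronglyMeasurable g volume → AEStronglyMeasurable (fun r => f r (g r)) volume :=
    fun hf hg => hap.comp_aestronglyMeasurable (hf.prodMk hg)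
  have hbdd : ∀ {f : ℝ → E →L[ℝ] E} {g : ℝ → E}, LocBdd f → LocBdd g →
      LocBdd (fun r => f r (g r)) := by
    intro f g hf hg N
    obtain ⟨C, hC⟩ := hf N
    obtain ⟨D, hD⟩ := hg N
    exact ⟨C * D, fun t ht => (f t).le_of_opNorm_le_of_le (hC t ht) (hD t ht)⟩
  have hint : ∀ {f : ℝ → E →L[ℝ] E} {g : ℝ → E}, LocBdd f → LocBdd g →
      AEStronglyMeasurable f volume → AEStronglyMeasurable g volume →
      LocallyIntegrable (fun r => f r (g r)) volume :=
    fun h1 h2 h3 h4 => (hbdd h1 h2).locallyIntegrable (hmeas h3 h4)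
  have mY' := hY.1.aestronglyMeasurable
  have mw' := hw.1.aestronglyMeasurable
  have i1 := hint hY' hwc.locBdd mY' hwc.aestronglyMeasurable
  have i2 := hint hYc.locBdd hw' hYc.aestronglyMeasurable mw'
  set q : ℝ → E := fun r => Y' r (w r) + Y r (w' r) with hq
  have iq : LocallyIntegrable q volume := i1.add i2
  refine ⟨iq, ?_⟩
  set e : ℝ → E := fun t => Y t (w t) - ∫ r in (0 : ℝ)..t, q r with he
  -- The defect `e` between the product and its expected primitive has increments of order |b - a|²,
  -- so its derivative vanishes everywhere and it is constant. No almost-everywhere differentiation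
  -- is needed.
  have hquad : ∀ N, ∃ C, ∀ a b, |a| ≤ N → |b| ≤ N → ‖e b - e a‖ ≤ C * |b - a| ^ 2 := by
    intro N
    obtain ⟨C, hC⟩ := hY' N
    obtain ⟨D, hD⟩ := hw' N
    refine ⟨2 * (C * D), fun a b ha hb => ?_⟩
    have hC0 : 0 ≤ C := (norm_nonneg _).trans (hC a ha)
    have hD0 : 0 ≤ D := (norm_nonneg _).trans (hD a ha)
    have hin : ∀ r ∈ uIoc a b, |r| ≤ N ∧ |b - r| ≤ |b - a| ∧ |a - r| ≤ |b - a| := by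
      intro r hr
      have hr' := uIoc_subset_uIcc hr
      refine ⟨?_, ?_, ?_⟩
      · rw [abs_le] at ha hb ⊢
        rcases mem_uIcc.mp hr' with h | h <;> constructor <;> linarith
      · rcases mem_uIcc.mp hr' with h | h
        · rw [abs_of_nonneg (by linarith), abs_of_nonneg (by linarith)]; linarith
        · rw [abs_of_nonpos (by linarith), abs_of_nonpos (by linarith)]; linarith
      · rcases mem_uIcc.mp hr' with h | h
        · rw [abs_of_nonpos (by linarith), abs_of_nonneg (by linarith)]; linarith
        · rw [abs_of_nonneg (by linarith), abs_of_nonpos (by linarith)]; linarith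
    have hwl : ∀ r ∈ uIoc a b, ‖w b - w r‖ ≤ D * |b - a| := by
      intro r hr
      rw [hw.2]
      refine (intervalIntegral.norm_integral_le_of_norm_le_const (C := D) ?_).trans
        (mul_le_mul_of_nonneg_left (hin r hr).2.1 hD0)
      intro u hu
      refine hD u ?_
      have h1 := (hin r hr).1
      have hu' := uIoc_subset_uIcc hu
      rw [abs_le] at h1 hb ⊢
      rcases mem_uIcc.mp hu' with h | h <;> constructor <;> linarith
    have hYl : ∀ r ∈ uIoc a b, ‖Y a - Y r‖ ≤ C * |b - a| := by
      intro r hr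
      rw [hY.2]
      refine (intervalIntegral.norm_integral_le_of_norm_le_const (C := C) ?_).trans
        (mul_le_mul_of_nonneg_left (hin r hr).2.2 hC0)
      intro u hu
      refine hC u ?_
      have h1 := (hin r hr).1
      have hu' := uIoc_subset_uIcc hu
      rw [abs_le] at h1 ha ⊢
      rcases mem_uIcc.mp hu' with h | h <;> constructor <;> linarith
    have hee : e b - e a = ∫ r in a..b, (Y' r (w b - w r) + (Y a - Y r) (w' r)) := by
      have e1 : (∫ r in (0 : ℝ)..b, q r) - ∫ r in (0 : ℝ)..a, q r = ∫ r in a..b, q r :=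
        intervalIntegral.integral_interval_sub_left (iq.intervalIntegrable_real _ _)
          (iq.intervalIntegrable_real _ _)
      have e2 : ∫ r in a..b, Y' r (w b) = Y b (w b) - Y a (w b) := by
        have := (hY.clm_apply_const (ContinuousLinearMap.apply ℝ E (w b))).2 a b
        exact this.symm
      have e3 : ∫ r in a..b, Y a (w' r) = Y a (w b) - Y a (w a) :=
        ((hw.clm_apply_const (Y a)).2 a b).symm
      have j1 := ((hY.clm_apply_const (ContinuousLinearMap.apply ℝ E (w b))).1).intervalIntegrable_real a b
      simp only [ContinuousLinearMap.apply_apply] at j1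
      have j2 := ((hw.clm_apply_const (Y a)).1).intervalIntegrable_real a b
      have e4 : (∫ r in a..b, (Y' r (w b - w r) + (Y a - Y r) (w' r)))
          = ∫ r in a..b, ((Y' r (w b) + Y a (w' r)) - q r) := by
        refine intervalIntegral.integral_congr fun r _ => ?_
        simp only [hq, map_sub, sub_apply]
        abel
      rw [e4, intervalIntegral.integral_sub (j1.add j2) (iq.intervalIntegrable_real a b),
        intervalIntegral.integral_add j1 j2, e2, e3, ← e1]
      simp only [he]
      abel
    rw [hee]
    refine (intervalIntegral.norm_integral_le_of_norm_le_const
      (C := C * (D * |b - a|) + C * |b - a| * D) fun r hr => ?_).trans (le_of_eq (by ring))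
    refine (norm_add_le _ _).trans (add_le_add ?_ ?_)
    · exact (Y' r).le_of_opNorm_le_of_le (hC r (hin r hr).1) (hwl r hr)
    · exact (Y a - Y r).le_of_opNorm_le_of_le (hYl r hr) (hD r (hin r hr).1)
  have hder : ∀ t, HasDerivAt e 0 t := by
    intro t
    obtain ⟨C, hC⟩ := hquad (|t| + 1)
    have hO : (fun u => e u - e t) =O[𝓝 t] fun u => ‖u - t‖ ^ 2 := by
      refine Asymptotics.IsBigO.of_bound C ?_
      filter_upwards [Metric.closedBall_mem_nhds t one_pos] with u hu
      have hu' : |u - t| ≤ 1 := by simpa [Real.dist_eq] using hu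
      have h1 : |u| ≤ |t| + 1 := by
        have := abs_add_le (u - t) t
        rw [sub_add_cancel] at this
        linarith
      have := hC t u (by linarith) h1
      simpa using this
    have := hO.hasFDerivAt (𝕜 := ℝ) (by norm_num)
    have h2 : HasFDerivAt e (0 : ℝ →L[ℝ] E) t := by
      simpa using this.add_const (e t)
    simpa using h2.hasDerivAt
  intro a b
  have hab : e b = e a :=
    is_const_of_deriv_eq_zero (f := e) (fun t => (hder t).differentiableAt) (fun t => (hder t).deriv) b a
  have e1 : (∫ r in (0 : ℝ)..b, q r) - ∫ r in (0 : ℝ)..a, q r = ∫ r in a..b, q r :=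
    intervalIntegral.integral_interval_sub_left (iq.intervalIntegrable_real _ _)
      (iq.intervalIntegrable_real _ _)
  rw [← e1]
  simp only [he] at hab
  rw [sub_eq_sub_iff_sub_eq_sub] at hab
  rw [← hab]

end Caratheodory

/-! ### Exponential dichotomies and variation of constants. -/

section Dichotomy

set_option linter.unusedSectionVars false

variable {E : Type*} [NormedAddCommGroup E] [NormedSpace ℝ E]

/-- The linear system `z' = M(t) z` with bounded coefficient matrix, its transition matrix `Z(t, s)`
and the projections `P(t)` of an exponential dichotomy on `ℝ`. -/
structure ExpDichotomy (M : ℝ → E →L[ℝ] E) (Z : ℝ → ℝ → E →L[ℝ] E) (P : ℝ → E →L[ℝ] E)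
    (K α β : ℝ) : Prop where
  meas : AEStronglyMeasurable M volume
  norm_le : ∀ t, ‖M t‖ ≤ β
  sol : ∀ s, IsPrimitive (fun t => (M t).comp (Z t s)) (fun t => Z t s)
  self : ∀ s x, Z s s x = x
  comp : ∀ t r s x, Z t r (Z r s x) = Z t s x
  proj : ∀ t x, P t (P t x) = P t x
  comm : ∀ t s x, Z t s (P s x) = P t (Z t s x)
  stable : ∀ t s x, s ≤ t → ‖Z t s (P s x)‖ ≤ K * Real.exp (-α * (t - s)) * ‖x‖
  unstable : ∀ t s x, t ≤ s → ‖Z t s (x - P s x)‖ ≤ K * Real.exp (-α * (s - t)) * ‖x‖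
  one_le : 1 ≤ K
  pos : 0 < α

/-- Time reversal of a coefficient matrix. -/
def revMat (M : ℝ → E →L[ℝ] E) : ℝ → E →L[ℝ] E := fun t => -M (-t)

/-- Time reversal of a transition matrix. -/
def revTrans (Z : ℝ → ℝ → E →L[ℝ] E) : ℝ → ℝ → E →L[ℝ] E := fun t s => Z (-t) (-s)

/-- The complementary projections in reversed time. -/
def revProj (P : ℝ → E →L[ℝ] E) : ℝ → E →L[ℝ] E := fun t => ContinuousLinearMap.id ℝ E - P (-t)

@[simp] theorem revMat_apply (M : ℝ → E →L[ℝ] E) (t : ℝ) (x : E) : revMat M t x = -M (-t) x := rfl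

@[simp] theorem revTrans_apply (Z : ℝ → ℝ → E →L[ℝ] E) (t s : ℝ) (x : E) :
    revTrans Z t s x = Z (-t) (-s) x := rfl

@[simp] theorem revProj_apply (P : ℝ → E →L[ℝ] E) (t : ℝ) (x : E) :
    revProj P t x = x - P (-t) x := rfl

theorem aestronglyMeasurable_comp_neg {V : Type*} [TopologicalSpace V] {k : ℝ → V}
    (hk : AEStronglyMeasurable k volume) :
    AEStronglyMeasurable (fun t => k (-t)) (volume : Measure ℝ) :=
  hk.comp_measurePreserving (Measure.measurePreserving_neg (volume : Measure ℝ))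

variable {M : ℝ → E →L[ℝ] E} {Z : ℝ → ℝ → E →L[ℝ] E} {P : ℝ → E →L[ℝ] E} {K α β : ℝ}

namespace ExpDichotomy

/-- Reversing time exchanges the two halves of the dichotomy, with the same constants. Every
statement about the unstable direction is obtained from its stable counterpart in this way. -/
theorem rev (D : ExpDichotomy M Z P K α β) :
    ExpDichotomy (revMat M) (revTrans Z) (revProj P) K α β where
  meas := (aestronglyMeasurable_comp_neg D.meas).neg
  norm_le t := by simpa [revMat] using D.norm_le (-t)
  sol s := by
    refine (D.sol (-s)).comp_neg.congr fun t => ?_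
    ext x; rfl
  self s x := D.self _ _
  comp t r s x := D.comp _ _ _ _
  proj t x := by simp [D.proj]
  comm t s x := by simp [D.comm]
  stable t s x h := by
    have := D.unstable (-t) (-s) x (neg_le_neg h)
    rwa [show -s - -t = t - s by ring] at this
  unstable t s x h := by
    have := D.stable (-t) (-s) x (neg_le_neg h)
    rw [show -t - -s = s - t by ring] at this
    simpa using this
  one_le := D.one_le
  pos := D.pos

theorem K_pos (D : ExpDichotomy M Z P K α β) : 0 < K := one_pos.trans_le D.one_le

theorem β_nonneg (D : ExpDichotomy M Z P K α β) : 0 ≤ β := (norm_nonneg _).trans (D.norm_le 0)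

theorem norm_proj_le (D : ExpDichotomy M Z P K α β) (t : ℝ) (x : E) : ‖P t x‖ ≤ K * ‖x‖ := by
  have := D.stable t t x le_rfl
  rwa [D.self, sub_self, mul_zero, Real.exp_zero, mul_one] at this

variable [CompleteSpace E]

theorem sol_apply (D : ExpDichotomy M Z P K α β) (s : ℝ) (x : E) :
    IsPrimitive (fun t => M t (Z t s x)) (fun t => Z t s x) :=
  (D.sol s).clm_apply_const (ContinuousLinearMap.apply ℝ E x)

theorem norm_trans_le (D : ExpDichotomy M Z P K α β) (t s : ℝ) (x : E) :
    ‖Z t s x‖ ≤ ‖x‖ * Real.exp (β * |t - s|) := by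
  have := (D.sol_apply s x).gronwall_abs D.β_nonneg
    (fun r => (M r).le_of_opNorm_le (D.norm_le r) _) s t
  rwa [D.self] at this

/-- The cocycle identity reduces joint continuity to continuity of the single curve Z(·, s₀)x₀, with
the error propagated by the growth bound e^{β|t-s|}. -/
theorem continuous_trans (D : ExpDichotomy M Z P K α β) :
    Continuous fun q : ℝ × ℝ × E => Z q.1 q.2.1 q.2.2 := by
  rw [continuous_iff_continuousAt]
  rintro ⟨t₀, s₀, x₀⟩
  have hc := (D.sol_apply s₀ x₀).continuous
  rw [ContinuousAt, tendsto_iff_norm_sub_tendsto_zero]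
  refine squeeze_zero (g := fun q : ℝ × ℝ × E =>
    ‖q.2.2 - Z q.2.1 s₀ x₀‖ * Real.exp (β * |q.1 - q.2.1|) + ‖Z q.1 s₀ x₀ - Z t₀ s₀ x₀‖)
    (fun _ => norm_nonneg _) (fun q => ?_) ?_
  · have e : Z q.1 q.2.1 q.2.2 - Z t₀ s₀ x₀
        = Z q.1 q.2.1 (q.2.2 - Z q.2.1 s₀ x₀) + (Z q.1 s₀ x₀ - Z t₀ s₀ x₀) := by
      rw [map_sub, D.comp]; abel
    rw [e]
    exact (norm_add_le _ _).trans (add_le_add_left (D.norm_trans_le _ _ _) _)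
  · have hc2 : Continuous fun q : ℝ × ℝ × E =>
        ‖q.2.2 - Z q.2.1 s₀ x₀‖ * Real.exp (β * |q.1 - q.2.1|) + ‖Z q.1 s₀ x₀ - Z t₀ s₀ x₀‖ := by
      have h1 : Continuous fun q : ℝ × ℝ × E => Z q.2.1 s₀ x₀ := hc.comp (by fun_prop)
      have h2 : Continuous fun q : ℝ × ℝ × E => Z q.1 s₀ x₀ := hc.comp (by fun_prop)
      fun_prop
    have := hc2.tendsto (t₀, s₀, x₀)
    simpa [D.self] using this

theorem proj_eq (D : ExpDichotomy M Z P K α β) (t : ℝ) (x : E) :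
    P t x = Z t 0 (P 0 (Z 0 t x)) := by
  rw [D.comm, D.comp, D.self]

theorem continuous_proj (D : ExpDichotomy M Z P K α β) :
    Continuous fun q : ℝ × E => P q.1 q.2 := by
  rw [show (fun q : ℝ × E => P q.1 q.2) = fun q => Z q.1 0 (P 0 (Z 0 q.1 q.2)) from
    funext fun q => D.proj_eq q.1 q.2]
  have h1 : Continuous fun q : ℝ × E => Z 0 q.1 q.2 := D.continuous_trans.comp (by fun_prop :
    Continuous fun q : ℝ × E => ((0 : ℝ), q.1, q.2))
  exact D.continuous_trans.comp (continuous_fst.prodMk (continuous_const.prodMk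
    ((P 0).continuous.comp h1)))

theorem aestronglyMeasurable_trans (D : ExpDichotomy M Z P K α β) {k : ℝ → E}
    (hk : AEStronglyMeasurable k volume) (t : ℝ) :
    AEStronglyMeasurable (fun s => Z t s (k s)) volume := by
  have hc : Continuous fun q : ℝ × E => Z t q.1 q.2 := D.continuous_trans.comp (by fun_prop :
    Continuous fun q : ℝ × E => (t, q.1, q.2))
  exact hc.comp_aestronglyMeasurable (aestronglyMeasurable_id.prodMk hk)

theorem aestronglyMeasurable_proj (D : ExpDichotomy M Z P K α β) {k : ℝ → E}
    (hk : AEStronglyMeasurable k volume) :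
    AEStronglyMeasurable (fun s => P s (k s)) volume :=
  D.continuous_proj.comp_aestronglyMeasurable (aestronglyMeasurable_id.prodMk hk)

theorem locBdd_trans (D : ExpDichotomy M Z P K α β) {k : ℝ → E} (hk : LocBdd k) (t : ℝ) :
    LocBdd (fun s => Z t s (k s)) := by
  intro N
  obtain ⟨C, hC⟩ := hk N
  refine ⟨C * Real.exp (β * (|t| + N)), fun s hs => (D.norm_trans_le t s _).trans ?_⟩
  have h1 : |t - s| ≤ |t| + N := (abs_sub t s).trans (add_le_add_right hs _)
  have h2 := mul_le_mul_of_nonneg_left h1 D.β_nonneg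
  exact mul_le_mul (hC s hs) (Real.exp_le_exp.mpr h2) (Real.exp_pos _).le
    ((norm_nonneg _).trans (hC s hs))

theorem locBdd_sol (D : ExpDichotomy M Z P K α β) (s : ℝ) :
    LocBdd (fun t => (M t).comp (Z t s)) := by
  intro N
  obtain ⟨C, hC⟩ := (D.sol s).continuous.locBdd N
  refine ⟨β * C, fun t ht => (ContinuousLinearMap.opNorm_comp_le _ _).trans ?_⟩
  exact mul_le_mul (D.norm_le t) (hC t ht) (norm_nonneg _) D.β_nonneg

theorem isPrimitive_of_primitive (D : ExpDichotomy M Z P K α β) {k w : ℝ → E} (hk : LocBdd k)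
    (hw : IsPrimitive (fun s => Z 0 s (k s)) w) :
    IsPrimitive (fun r => M r (Z r 0 (w r)) + k r) (fun r => Z r 0 (w r)) := by
  refine ((D.sol 0).clm_apply hw (D.locBdd_sol 0) (D.locBdd_trans hk 0)).congr fun r => ?_
  rw [D.comp, D.self]
  rfl

theorem eq_of_eq (D : ExpDichotomy M Z P K α β) {k v₁ v₂ : ℝ → E}
    (h₁ : IsPrimitive (fun r => M r (v₁ r) + k r) v₁)
    (h₂ : IsPrimitive (fun r => M r (v₂ r) + k r) v₂) {s : ℝ} (h : v₁ s = v₂ s) (t : ℝ) :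
    v₁ t = v₂ t := by
  have := (h₁.sub h₂).gronwall_abs D.β_nonneg (fun r => by
    rw [add_sub_add_right_eq_sub, ← map_sub]
    exact (M r).le_of_opNorm_le (D.norm_le r) _) s t
  rw [h, sub_self, norm_zero, zero_mul] at this
  exact sub_eq_zero.mp (norm_le_zero_iff.mp this)

/-- Variation of constants: existence. -/
theorem isPrimitive_variation (D : ExpDichotomy M Z P K α β) {k : ℝ → E} (hk : LocBdd k)
    (hm : AEStronglyMeasurable k volume) (s : ℝ) (x : E) :
    IsPrimitive (fun t => M t (Z t s x + ∫ r in s..t, Z t r (k r)) + k t)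
      (fun t => Z t s x + ∫ r in s..t, Z t r (k r)) := by
  have hl := (D.locBdd_trans hk 0).locallyIntegrable (D.aestronglyMeasurable_trans hm 0)
  have h := D.isPrimitive_of_primitive hk (isPrimitive_primitive hl s (Z 0 s x))
  have e : ∀ t, Z t 0 (Z 0 s x + ∫ r in s..t, Z 0 r (k r)) = Z t s x + ∫ r in s..t, Z t r (k r) := by
    intro t
    rw [map_add, D.comp, ← (Z t 0).intervalIntegral_comp_comm (hl.intervalIntegrable_real _ _)]
    simp_rw [D.comp]
  simpa only [e] using h

/-- Variation of constants: uniqueness. -/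
theorem variation (D : ExpDichotomy M Z P K α β) {k v : ℝ → E} (hk : LocBdd k)
    (hm : AEStronglyMeasurable k volume) (hv : IsPrimitive (fun t => M t (v t) + k t) v) (s t : ℝ) :
    v t = Z t s (v s) + ∫ r in s..t, Z t r (k r) :=
  D.eq_of_eq hv (D.isPrimitive_variation hk hm s (v s)) (s := s) (by simp [D.self]) t

end ExpDichotomy

/-- The adapted seminorm `sup_{r ≥ 0} e^{αr} |Z(t+r, t) P(t) x|`. -/
noncomputable def stableNorm (Z : ℝ → ℝ → E →L[ℝ] E) (P : ℝ → E →L[ℝ] E) (α t : ℝ) (x : E) : ℝ :=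
  ⨆ r : NNReal, Real.exp (α * r) * ‖Z (t + r) t (P t x)‖

/-- The adapted seminorm in the unstable direction. -/
noncomputable def unstableNorm (Z : ℝ → ℝ → E →L[ℝ] E) (P : ℝ → E →L[ℝ] E) (α t : ℝ) (x : E) : ℝ :=
  stableNorm (revTrans Z) (revProj P) α (-t) x

/-! ### Adapted seminorms and bounded solutions of inhomogeneous and Lipschitz perturbed systems. -/

namespace ExpDichotomy

theorem exp_mul_norm_le (D : ExpDichotomy M Z P K α β) (t : ℝ) (x : E) (r : NNReal) :
    Real.exp (α * r) * ‖Z (t + r) t (P t x)‖ ≤ K * ‖x‖ := by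
  have h := D.stable (t + r) t x (by simp)
  rw [add_sub_cancel_left] at h
  have h2 : Real.exp (α * r) * Real.exp (-α * r) = 1 := by
    rw [← Real.exp_add]; simp
  calc _ ≤ Real.exp (α * r) * (K * Real.exp (-α * r) * ‖x‖) :=
        mul_le_mul_of_nonneg_left h (Real.exp_pos _).le
    _ = (Real.exp (α * r) * Real.exp (-α * r)) * (K * ‖x‖) := by ring
    _ = K * ‖x‖ := by rw [h2, one_mul]

theorem bddAbove (D : ExpDichotomy M Z P K α β) (t : ℝ) (x : E) :
    BddAbove (range fun r : NNReal => Real.exp (α * r) * ‖Z (t + r) t (P t x)‖) := by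
  refine ⟨K * ‖x‖, ?_⟩
  rintro _ ⟨r, rfl⟩
  exact D.exp_mul_norm_le t x r

theorem le_stableNorm (D : ExpDichotomy M Z P K α β) {t s : ℝ} (h : t ≤ s) (x : E) :
    Real.exp (α * (s - t)) * ‖Z s t (P t x)‖ ≤ stableNorm Z P α t x := by
  have := le_ciSup (D.bddAbove t x) ⟨s - t, sub_nonneg.mpr h⟩
  change Real.exp (α * (s - t)) * ‖Z (t + (s - t)) t (P t x)‖ ≤ stableNorm Z P α t x at this
  rwa [add_sub_cancel] at this

theorem stableNorm_le (t : ℝ) (x : E) {C : ℝ}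
    (h : ∀ s, t ≤ s → Real.exp (α * (s - t)) * ‖Z s t (P t x)‖ ≤ C) : stableNorm Z P α t x ≤ C := by
  refine ciSup_le fun r => ?_
  have := h (t + r) (by simp)
  simpa using this

theorem stableNorm_le_norm (D : ExpDichotomy M Z P K α β) (t : ℝ) (x : E) :
    stableNorm Z P α t x ≤ K * ‖x‖ :=
  ciSup_le fun r => D.exp_mul_norm_le t x r

theorem norm_proj_le_stableNorm (D : ExpDichotomy M Z P K α β) (t : ℝ) (x : E) :
    ‖P t x‖ ≤ stableNorm Z P α t x := by
  simpa [D.self] using D.le_stableNorm (le_refl t) x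

theorem stableNorm_nonneg (D : ExpDichotomy M Z P K α β) (t : ℝ) (x : E) :
    0 ≤ stableNorm Z P α t x :=
  (norm_nonneg _).trans (D.norm_proj_le_stableNorm t x)

theorem norm_le_add (D : ExpDichotomy M Z P K α β) (t : ℝ) (x : E) :
    ‖x‖ ≤ stableNorm Z P α t x + unstableNorm Z P α t x := by
  have h1 := D.norm_proj_le_stableNorm t x
  have h2 := D.rev.norm_proj_le_stableNorm (-t) x
  rw [revProj_apply, neg_neg] at h2
  have h3 := norm_add_le (P t x) (x - P t x)
  rw [add_sub_cancel] at h3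
  exact h3.trans (add_le_add h1 h2)

theorem stableNorm_add_le (D : ExpDichotomy M Z P K α β) (t : ℝ) (x y : E) :
    stableNorm Z P α t (x + y) ≤ stableNorm Z P α t x + stableNorm Z P α t y := by
  refine stableNorm_le t _ fun s hs => ?_
  refine le_trans ?_ (add_le_add (D.le_stableNorm hs x) (D.le_stableNorm hs y))
  rw [← mul_add, map_add, map_add]
  exact mul_le_mul_of_nonneg_left (norm_add_le _ _) (Real.exp_pos _).le

theorem stableNorm_eq_of_proj_eq {t : ℝ} {x y : E} (h : P t x = P t y) : stableNorm Z P α t x = stableNorm Z P α t y := by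
  simp only [stableNorm, h]

theorem abs_stableNorm_sub_le (D : ExpDichotomy M Z P K α β) (t : ℝ) (x y : E) :
    |stableNorm Z P α t x - stableNorm Z P α t y| ≤ K * ‖x - y‖ := by
  have h1 := D.stableNorm_add_le t (x - y) y
  have h2 := D.stableNorm_add_le t (y - x) x
  rw [sub_add_cancel] at h1 h2
  have h3 := D.stableNorm_le_norm t (x - y)
  have h4 := D.stableNorm_le_norm t (y - x)
  rw [norm_sub_rev y x] at h4
  rw [abs_le]; constructor <;> linarith

/-- The gain over the original norm: the decay holds with factor 1 instead of K, because the
supremum at the later time runs over a part of the same orbit. -/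
theorem stableNorm_trans_le (D : ExpDichotomy M Z P K α β) {s t : ℝ} (h : s ≤ t) (x : E) :
    stableNorm Z P α t (Z t s x) ≤ Real.exp (-α * (t - s)) * stableNorm Z P α s x := by
  refine stableNorm_le t _ fun r hr => ?_
  rw [← D.comm, D.comp]
  have := mul_le_mul_of_nonneg_left (D.le_stableNorm (h.trans hr) x)
    (Real.exp_pos (-α * (t - s))).le
  rw [← mul_assoc, ← Real.exp_add] at this
  rwa [show -α * (t - s) + α * (r - s) = α * (r - t) by ring] at this

variable [CompleteSpace E]

/-- The supremum at time `s` involves additional times between `s` and `t`; there the crude growth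
bound of rate β is used. -/
theorem stableNorm_trans_backward_le (D : ExpDichotomy M Z P K α β) {s t : ℝ} (h : s ≤ t) (x : E) :
    stableNorm Z P α s (Z s t x) ≤ Real.exp ((α + β) * (t - s)) * stableNorm Z P α t x := by
  have hβ := D.β_nonneg
  have hα := D.pos
  refine stableNorm_le s _ fun r hr => ?_
  rw [← D.comm, D.comp]
  rcases le_total t r with htr | htr
  · have h1 := D.le_stableNorm htr x
    have h2 := mul_le_mul_of_nonneg_left h1 (Real.exp_pos ((α + β) * (t - s))).le
    refine le_trans ?_ h2
    rw [← mul_assoc, ← Real.exp_add]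
    refine mul_le_mul_of_nonneg_right (Real.exp_le_exp.mpr ?_) (norm_nonneg _)
    have := mul_nonneg hβ (sub_nonneg.mpr h)
    nlinarith
  · have h1 := D.norm_trans_le r t (P t x)
    have h2 := D.norm_proj_le_stableNorm t x
    rw [abs_of_nonpos (sub_nonpos.mpr htr)] at h1
    calc _ ≤ Real.exp (α * (r - s)) * (stableNorm Z P α t x * Real.exp (β * -(r - t))) := by
          refine mul_le_mul_of_nonneg_left (h1.trans ?_) (Real.exp_pos _).le
          exact mul_le_mul_of_nonneg_right h2 (Real.exp_pos _).le
      _ = Real.exp (α * (r - s) + β * -(r - t)) * stableNorm Z P α t x := by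
          rw [Real.exp_add]; ring
      _ ≤ _ := by
          refine mul_le_mul_of_nonneg_right (Real.exp_le_exp.mpr ?_) (D.stableNorm_nonneg _ _)
          have h3 := mul_nonneg hβ (sub_nonneg.mpr hr)
          have h4 := mul_nonneg hα.le (sub_nonneg.mpr htr)
          nlinarith

/-- A supremum of continuous functions is in general only lower semicontinuous. Here the forward and
backward estimates squeeze the seminorm between e^{∓(α+β)|t-t₀|} times the seminorm at the fixed
time t₀ of the transported vector, and at a fixed time it is Lipschitz. -/
theorem continuous_stableNorm (D : ExpDichotomy M Z P K α β) :
    Continuous fun q : ℝ × E => stableNorm Z P α q.1 q.2 := by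
  rw [continuous_iff_continuousAt]
  rintro ⟨t₀, x₀⟩
  have hβ := D.β_nonneg
  have hα := D.pos
  set N : ℝ × E → ℝ := fun q => stableNorm Z P α t₀ (Z t₀ q.1 q.2) with hN
  have hNc : Continuous N := by
    have hs : Continuous fun x => stableNorm Z P α t₀ x := by
      refine (LipschitzWith.of_dist_le_mul (K := ⟨K, D.K_pos.le⟩) fun x y => ?_).continuous
      rw [Real.dist_eq, dist_eq_norm]
      exact D.abs_stableNorm_sub_le t₀ x y
    exact hs.comp (D.continuous_trans.comp (by fun_prop : Continuous fun q : ℝ × E =>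
      (t₀, q.1, q.2)))
  have hN0 : N (t₀, x₀) = stableNorm Z P α t₀ x₀ := by simp [hN, D.self]
  have hup : ∀ q : ℝ × E, stableNorm Z P α q.1 q.2 ≤ Real.exp ((α + β) * |q.1 - t₀|) * N q := by
    rintro ⟨t, x⟩
    have e : stableNorm Z P α t x = stableNorm Z P α t (Z t t₀ (Z t₀ t x)) := by
      rw [D.comp, D.self]
    change stableNorm Z P α t x ≤ Real.exp ((α + β) * |t - t₀|) * N (t, x)
    rw [e]
    rcases le_total t₀ t with h | h
    · refine (D.stableNorm_trans_le h _).trans ?_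
      refine mul_le_mul_of_nonneg_right (Real.exp_le_exp.mpr ?_) (D.stableNorm_nonneg _ _)
      rw [abs_of_nonneg (sub_nonneg.mpr h)]
      have := sub_nonneg.mpr h
      nlinarith [mul_nonneg hβ this, mul_nonneg hα.le this]
    · refine (D.stableNorm_trans_backward_le h _).trans (le_of_eq ?_)
      rw [abs_of_nonpos (sub_nonpos.mpr h), neg_sub]
  have hlo : ∀ q : ℝ × E, N q ≤ Real.exp ((α + β) * |q.1 - t₀|) * stableNorm Z P α q.1 q.2 := by
    rintro ⟨t, x⟩
    change stableNorm Z P α t₀ (Z t₀ t x) ≤ Real.exp ((α + β) * |t - t₀|) * stableNorm Z P α t x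
    rcases le_total t t₀ with h | h
    · refine (D.stableNorm_trans_le h _).trans ?_
      refine mul_le_mul_of_nonneg_right (Real.exp_le_exp.mpr ?_) (D.stableNorm_nonneg _ _)
      rw [abs_of_nonpos (sub_nonpos.mpr h)]
      have := sub_nonneg.mpr h
      nlinarith [mul_nonneg hβ this, mul_nonneg hα.le this]
    · refine (D.stableNorm_trans_backward_le h _).trans (le_of_eq ?_)
      rw [abs_of_nonneg (sub_nonneg.mpr h)]
  have hlo' : ∀ q : ℝ × E, Real.exp (-((α + β) * |q.1 - t₀|)) * N q ≤ stableNorm Z P α q.1 q.2 := by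
    intro q
    rw [Real.exp_neg, inv_mul_le_iff₀ (Real.exp_pos _)]
    exact hlo q
  refine tendsto_of_tendsto_of_tendsto_of_le_of_le (g := fun q : ℝ × E =>
    Real.exp (-((α + β) * |q.1 - t₀|)) * N q)
    (h := fun q : ℝ × E => Real.exp ((α + β) * |q.1 - t₀|) * N q) ?_ ?_ hlo' hup
  · have : Continuous fun q : ℝ × E => Real.exp (-((α + β) * |q.1 - t₀|)) * N q := by fun_prop
    have := this.tendsto (t₀, x₀)
    simpa [hN0] using this
  · have : Continuous fun q : ℝ × E => Real.exp ((α + β) * |q.1 - t₀|) * N q := by fun_prop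
    have := this.tendsto (t₀, x₀)
    simpa [hN0] using this

theorem integral_exp_eq (hα : α ≠ 0) (s t : ℝ) :
    ∫ r in s..t, Real.exp (-α * (t - r)) = (1 - Real.exp (-α * (t - s))) / α := by
  have hc : Continuous fun r => Real.exp (-α * (t - r)) := by fun_prop
  rw [intervalIntegral.integral_eq_sub_of_hasDerivAt
    (f := fun r => Real.exp (-α * (t - r)) / α) (fun r _ => ?_) (hc.intervalIntegrable _ _)]
  · simp [sub_div]
  · have := ((((hasDerivAt_id r).const_sub t).const_mul (-α)).exp).div_const α
    have e1 : Real.exp (-α * (t - r)) * (-α * -1) / α = Real.exp (-α * (t - r)) := by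
      field_simp
    rw [← e1]
    exact this

/-- Growth of the stable component under a bounded inhomogeneity. -/
theorem stableNorm_variation_le (D : ExpDichotomy M Z P K α β) {k v : ℝ → E} (hk : LocBdd k)
    (hm : AEStronglyMeasurable k volume) (hv : IsPrimitive (fun t => M t (v t) + k t) v)
    {s t κ : ℝ} (hst : s ≤ t) (hκ : ∀ r ∈ Icc s t, ‖k r‖ ≤ κ) :
    stableNorm Z P α t (v t) ≤ Real.exp (-α * (t - s)) * stableNorm Z P α s (v s)
      + K * κ / α * (1 - Real.exp (-α * (t - s))) := by
  have hI : stableNorm Z P α t (∫ r in s..t, Z t r (k r))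
      ≤ K * κ / α * (1 - Real.exp (-α * (t - s))) := by
    refine stableNorm_le t _ fun u hu => ?_
    have hl := (D.locBdd_trans hk t).locallyIntegrable (D.aestronglyMeasurable_trans hm t)
    have e : Z u t (P t (∫ r in s..t, Z t r (k r))) = ∫ r in s..t, Z u r (P r (k r)) := by
      rw [← ContinuousLinearMap.comp_apply, ← ContinuousLinearMap.intervalIntegral_comp_comm _
        (hl.intervalIntegrable_real _ _)]
      refine intervalIntegral.integral_congr fun r _ => ?_
      simp only [ContinuousLinearMap.comp_apply]
      rw [← D.comm, D.comp]
    have hc : Continuous fun r => K * κ * Real.exp (-α * (u - t)) * Real.exp (-α * (t - r)) := by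
      fun_prop
    have hb : ‖∫ r in s..t, Z u r (P r (k r))‖
        ≤ ∫ r in s..t, K * κ * Real.exp (-α * (u - t)) * Real.exp (-α * (t - r)) := by
      refine intervalIntegral.norm_integral_le_of_norm_le hst
        (Eventually.of_forall fun r hr => ?_) (hc.intervalIntegrable _ _)
      refine (D.stable u r (k r) (hr.2.trans hu)).trans ?_
      rw [show -α * (u - r) = -α * (u - t) + -α * (t - r) by ring, Real.exp_add]
      have h1 := hκ r ⟨hr.1.le, hr.2⟩
      have h2 : 0 ≤ K * (Real.exp (-α * (u - t)) * Real.exp (-α * (t - r))) := by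
        have := D.K_pos; positivity
      have h3 := mul_le_mul_of_nonneg_left h1 h2
      linarith
    rw [intervalIntegral.integral_const_mul, integral_exp_eq D.pos.ne'] at hb
    rw [e]
    refine (mul_le_mul_of_nonneg_left hb (Real.exp_pos _).le).trans (le_of_eq ?_)
    have h4 : Real.exp (α * (u - t)) * Real.exp (-α * (u - t)) = 1 := by
      rw [← Real.exp_add]; simp
    calc _ = (Real.exp (α * (u - t)) * Real.exp (-α * (u - t))) *
          (K * κ / α * (1 - Real.exp (-α * (t - s)))) := by ring
      _ = _ := by rw [h4, one_mul]
  rw [D.variation hk hm hv s t]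
  exact (D.stableNorm_add_le _ _ _).trans (add_le_add (D.stableNorm_trans_le hst _) hI)

/-- The stable component of a solution bounded in the past. -/
theorem stableNorm_le_of_bdd (D : ExpDichotomy M Z P K α β) {k v : ℝ → E} (hk : LocBdd k)
    (hm : AEStronglyMeasurable k volume) (hv : IsPrimitive (fun t => M t (v t) + k t) v)
    {t κ C : ℝ} (hκ : ∀ r ≤ t, ‖k r‖ ≤ κ) (hC : ∀ r ≤ t, ‖v r‖ ≤ C) :
    stableNorm Z P α t (v t) ≤ K * κ / α := by
  have hK := D.K_pos
  have hα := D.pos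
  have hκ0 : 0 ≤ κ := (norm_nonneg _).trans (hκ t le_rfl)
  -- The initial time `s` is sent to -∞: the contribution of the bounded initial value disappears.
  have hlim : Tendsto (fun s => Real.exp (-α * (t - s)) * (K * C) + K * κ / α) atBot
      (𝓝 (0 * (K * C) + K * κ / α)) := by
    refine (Tendsto.mul_const _ ?_).add_const _
    refine Real.tendsto_exp_atBot.comp ?_
    have h1 : Tendsto (fun s => α * s + -α * t) atBot atBot :=
      tendsto_atBot_add_const_right _ _ (tendsto_id.const_mul_atBot hα)
    refine h1.congr fun s => by ring
  rw [zero_mul, zero_add] at hlim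
  refine ge_of_tendsto hlim ?_
  filter_upwards [eventually_le_atBot t] with s hs
  refine (D.stableNorm_variation_le hk hm hv hs fun r hr => hκ r hr.2).trans ?_
  refine add_le_add (mul_le_mul_of_nonneg_left ?_ (Real.exp_pos _).le) ?_
  · exact (D.stableNorm_le_norm s _).trans (mul_le_mul_of_nonneg_left (hC s hs) hK.le)
  · have h1 : 0 ≤ K * κ / α := by positivity
    have h2 := (Real.exp_pos (-α * (t - s))).le
    nlinarith

theorem _root_.LocBdd.comp_neg {k : ℝ → E} (hk : LocBdd k) : LocBdd (fun t => -k (-t)) := by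
  intro N
  obtain ⟨C, hC⟩ := hk N
  exact ⟨C, fun t ht => by simpa using hC (-t) (by simpa using ht)⟩

theorem isPrimitive_rev {k v : ℝ → E} (hv : IsPrimitive (fun t => M t (v t) + k t) v) :
    IsPrimitive (fun t => revMat M t (v (-t)) + -k (-t)) (fun t => v (-t)) :=
  hv.comp_neg.congr fun t => by simp [add_comm]

/-- The unstable component of a solution bounded in the future. -/
theorem unstableNorm_le_of_bdd (D : ExpDichotomy M Z P K α β) {k v : ℝ → E} (hk : LocBdd k)
    (hm : AEStronglyMeasurable k volume) (hv : IsPrimitive (fun t => M t (v t) + k t) v)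
    {t κ C : ℝ} (hκ : ∀ r, t ≤ r → ‖k r‖ ≤ κ) (hC : ∀ r, t ≤ r → ‖v r‖ ≤ C) :
    unstableNorm Z P α t (v t) ≤ K * κ / α := by
  have := D.rev.stableNorm_le_of_bdd (k := fun t => -k (-t)) hk.comp_neg
    (aestronglyMeasurable_comp_neg hm).neg (isPrimitive_rev hv) (t := -t) (κ := κ) (C := C)
    (fun r hr => by simpa using hκ (-r) (by linarith)) (fun r hr => hC (-r) (by linarith))
  simpa [unstableNorm] using this

/-- A priori bound for bounded solutions of the inhomogeneous linear system. -/
theorem norm_le_of_bdd (D : ExpDichotomy M Z P K α β) {k v : ℝ → E}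
    (hm : AEStronglyMeasurable k volume) (hv : IsPrimitive (fun t => M t (v t) + k t) v)
    {κ C : ℝ} (hκ : ∀ r, ‖k r‖ ≤ κ) (hC : ∀ r, ‖v r‖ ≤ C) (t : ℝ) :
    ‖v t‖ ≤ 2 * K * κ / α := by
  have hk : LocBdd k := fun _ => ⟨κ, fun t _ => hκ t⟩
  have h1 := D.stableNorm_le_of_bdd hk hm hv (t := t) (fun r _ => hκ r) (fun r _ => hC r)
  have h2 := D.unstableNorm_le_of_bdd hk hm hv (t := t) (fun r _ => hκ r) (fun r _ => hC r)
  refine (D.norm_le_add t (v t)).trans ((add_le_add h1 h2).trans (le_of_eq (by ring)))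

theorem integrableOn_exp_Iic (hα : 0 < α) (t : ℝ) :
    IntegrableOn (fun s => Real.exp (-α * (t - s))) (Iic t) volume := by
  have := (integrableOn_exp_mul_Iic hα t).const_mul (Real.exp (-α * t))
  refine this.congr (Eventually.of_forall fun s => ?_)
  simp only [← Real.exp_add]
  congr 1; ring

theorem setIntegral_exp_Iic (hα : 0 < α) (t : ℝ) :
    ∫ s in Iic t, Real.exp (-α * (t - s)) = 1 / α := by
  have e : ∀ s, Real.exp (-α * (t - s)) = Real.exp (-α * t) * Real.exp (α * s) := by
    intro s; rw [← Real.exp_add]; congr 1; ring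
  simp_rw [e]
  rw [integral_const_mul, integral_exp_mul_Iic hα, ← mul_div_assoc, ← Real.exp_add]
  simp

/-- The solution is the stable half of the Green function integral, ∫_{-∞}^t Z(t,s)P(s)k(s) ds,
written as Z(t,0)w(t) so that the product rule applies. -/
theorem exists_bdd_stable (D : ExpDichotomy M Z P K α β) {k : ℝ → E}
    (hm : AEStronglyMeasurable k volume) {κ : ℝ} (hκ : ∀ r, ‖k r‖ ≤ κ) :
    ∃ v, IsPrimitive (fun t => M t (v t) + P t (k t)) v ∧ ∃ C, ∀ t, ‖v t‖ ≤ C := by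
  have hK := D.K_pos
  have hα := D.pos
  have hk' : LocBdd (fun t => P t (k t)) := fun N => ⟨K * κ, fun t _ =>
    (D.norm_proj_le t _).trans (mul_le_mul_of_nonneg_left (hκ t) hK.le)⟩
  have hm' := D.aestronglyMeasurable_proj hm
  have hb : ∀ t s, s ≤ t → ‖Z t s (P s (k s))‖ ≤ K * κ * Real.exp (-α * (t - s)) := by
    intro t s hs
    refine (D.stable t s _ hs).trans ?_
    have := mul_le_mul_of_nonneg_left (hκ s)
      (mul_nonneg hK.le (Real.exp_pos (-α * (t - s))).le)
    linarith
  have hint : ∀ t, IntegrableOn (fun s => Z t s (P s (k s))) (Iic t) volume := by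
    intro t
    refine Integrable.mono' ((integrableOn_exp_Iic hα t).const_mul (K * κ))
      (D.aestronglyMeasurable_trans hm' t).restrict ?_
    exact (ae_restrict_iff' measurableSet_Iic).mpr (Eventually.of_forall fun s hs => hb t s hs)
  have hint0 : ∀ t, IntegrableOn (fun s => Z 0 s (P s (k s))) (Iic t) volume := by
    intro t
    have := (Z 0 t).integrable_comp (hint t)
    simp only [D.comp] at this
    exact this
  set w : ℝ → E := fun t => ∫ s in Iic t, Z 0 s (P s (k s)) with hw
  have hwp : IsPrimitive (fun s => Z 0 s (P s (k s))) w := by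
    refine ⟨(D.locBdd_trans hk' 0).locallyIntegrable (D.aestronglyMeasurable_trans hm' 0),
      fun a b => ?_⟩
    exact intervalIntegral.integral_Iic_sub_Iic (hint0 a) (hint0 b)
  refine ⟨fun r => Z r 0 (w r), D.isPrimitive_of_primitive hk' hwp, K * κ * (1 / α), fun t => ?_⟩
  have e : Z t 0 (w t) = ∫ s in Iic t, Z t s (P s (k s)) := by
    rw [hw, ← ContinuousLinearMap.integral_comp_comm _ (hint0 t)]
    simp only [D.comp]
  beta_reduce
  rw [e, ← setIntegral_exp_Iic hα t, ← integral_const_mul]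
  refine norm_integral_le_of_norm_le ((integrableOn_exp_Iic hα t).const_mul (K * κ)) ?_
  exact (ae_restrict_iff' measurableSet_Iic).mpr (Eventually.of_forall fun s hs => hb t s hs)

/-- Bounded solutions of the inhomogeneous linear system exist. -/
theorem exists_bdd (D : ExpDichotomy M Z P K α β) {k : ℝ → E}
    (hm : AEStronglyMeasurable k volume) {κ : ℝ} (hκ : ∀ r, ‖k r‖ ≤ κ) :
    ∃ v, IsPrimitive (fun t => M t (v t) + k t) v ∧ ∃ C, ∀ t, ‖v t‖ ≤ C := by
  obtain ⟨v, hv, C, hC⟩ := D.exists_bdd_stable hm hκ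
  -- The other half of the forcing, (I - P)k, is the stable half of the reversed system.
  obtain ⟨u, hu, C', hC'⟩ := D.rev.exists_bdd_stable (k := fun t => -k (-t))
    (aestronglyMeasurable_comp_neg hm).neg (κ := κ) (fun r => by simpa using hκ (-r))
  refine ⟨fun t => v t + u (-t), (hv.add hu.comp_neg).congr fun t => ?_, C + C',
    fun t => (norm_add_le _ _).trans (add_le_add (hC t) (hC' (-t)))⟩
  simp
  abel

/-- Bounded solutions of a Lipschitz perturbation: a priori bound. -/
theorem norm_le_of_bdd_lip (D : ExpDichotomy M Z P K α β) {L κ C : ℝ} (hL : 2 * K * L < α)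
    (hL0 : 0 ≤ L) {k v : ℝ → E} (hm : AEStronglyMeasurable k volume)
    (hv : IsPrimitive (fun t => M t (v t) + k t) v) (hk : ∀ t, ‖k t‖ ≤ κ + L * ‖v t‖)
    (hC : ∀ t, ‖v t‖ ≤ C) (t : ℝ) : ‖v t‖ ≤ 2 * K * κ / (α - 2 * K * L) := by
  -- The linear a priori bound gives S ≤ 2K(κ + LS)/α, and the term in S is absorbed because 2KL <
  -- α.
  set S := ⨆ t, ‖v t‖ with hS
  have hbdd : BddAbove (range fun t => ‖v t‖) := ⟨C, by rintro _ ⟨t, rfl⟩; exact hC t⟩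
  have hle : ∀ t, ‖v t‖ ≤ S := fun t => le_ciSup hbdd t
  have h1 : S ≤ 2 * K * (κ + L * S) / α := ciSup_le fun t =>
    D.norm_le_of_bdd hm hv (fun r => (hk r).trans (by
      have := mul_le_mul_of_nonneg_left (hle r) hL0
      linarith)) hC t
  rw [le_div_iff₀ D.pos] at h1
  refine (hle t).trans ?_
  rw [le_div_iff₀ (by linarith)]
  nlinarith

/-- Bounded solutions of a Lipschitz perturbation: existence. -/
theorem exists_bdd_lip (D : ExpDichotomy M Z P K α β) {L : ℝ} (hL : 2 * K * L < α) {k : ℝ → E → E}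
    (hk : IsLipField k L) :
    ∃ v, IsSolution (fun t x => M t x + k t x) v ∧ ∃ C, ∀ t, ‖v t‖ ≤ C := by
  obtain ⟨κ, hκ⟩ := hk.bdd
  have hK := D.K_pos
  have hα := D.pos
  have hb : ∀ (y : BoundedContinuousFunction ℝ E) t, ‖k t (y t)‖ ≤ κ + L * ‖y‖ := fun y t =>
    (hk.norm_le hκ t _).trans
      (add_le_add_right (mul_le_mul_of_nonneg_left (y.norm_coe_le_norm t) hk.nonneg) _)
  have hm : ∀ y : BoundedContinuousFunction ℝ E,
      AEStronglyMeasurable (fun t => k t (y t)) volume := fun y =>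
    hk.aestronglyMeasurable y.continuous
  choose v hv C hC using fun y : BoundedContinuousFunction ℝ E => D.exists_bdd (hm y) (hb y)
  let T : BoundedContinuousFunction ℝ E → BoundedContinuousFunction ℝ E := fun y =>
    BoundedContinuousFunction.ofNormedAddCommGroup (v y) (hv y).continuous (C y) (hC y)
  have hT : ∀ y t, T y t = v y t := fun _ _ => rfl
  -- The contraction constant: the linear a priori bound 2Kκ/α applied to the forcing difference, of
  -- size at most L times the distance.
  set q : NNReal := ⟨2 * K * L / α, by have := hk.nonneg; positivity⟩ with hq
  have hcon : ContractingWith q T := by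
    refine ⟨by
      rw [← NNReal.coe_lt_coe]
      exact (div_lt_one hα).mpr hL,
      LipschitzWith.of_dist_le_mul fun y₁ y₂ => ?_⟩
    rw [BoundedContinuousFunction.dist_le (by positivity)]
    intro t
    rw [dist_eq_norm, hT, hT]
    have h1 : IsPrimitive (fun t => M t (v y₁ t - v y₂ t) + (k t (y₁ t) - k t (y₂ t)))
        (fun t => v y₁ t - v y₂ t) :=
      ((hv y₁).sub (hv y₂)).congr fun t => by rw [map_sub]; abel
    have h2 := D.norm_le_of_bdd ((hm y₁).sub (hm y₂)) h1 (κ := L * dist y₁ y₂)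
      (C := C y₁ + C y₂) (fun r => ?_) (fun r => ?_) t
    · refine h2.trans (le_of_eq ?_)
      change _ = 2 * K * L / α * dist y₁ y₂
      ring
    · refine (hk.lip r _ _).trans (mul_le_mul_of_nonneg_left ?_ hk.nonneg)
      rw [← dist_eq_norm]
      exact y₁.dist_coe_le_dist r
    · exact (norm_sub_le _ _).trans (add_le_add (hC _ r) (hC _ r))
  set y := ContractingWith.fixedPoint T hcon with hy
  have hfix : T y = y := hcon.fixedPoint_isFixedPt
  have hvy : v y = y := by
    funext t
    rw [← hT, hfix]
  refine ⟨v y, ?_, C y, hC y⟩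
  have h := hv y
  refine h.congr fun t => ?_
  rw [hvy]

end ExpDichotomy

end Dichotomy

/-! ### The perturbed system: stable manifold, brackets and the cone estimate. -/

section Perturbation

set_option linter.unusedSectionVars false

variable {E : Type*} [NormedAddCommGroup E] [NormedSpace ℝ E]

/-- The right-hand side `M(t) x + h(t, x)` of the perturbed system. -/
def field (M : ℝ → E →L[ℝ] E) (h : ℝ → E → E) : ℝ → E → E := fun t x => M t x + h t x

/-- Time reversal of a nonlinearity. -/
def revPert (h : ℝ → E → E) : ℝ → E → E := fun t x => -h (-t) x

/-- A Lipschitz nonlinearity vanishing at the origin. -/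
structure IsPert (h : ℝ → E → E) (L : ℝ) : Prop extends IsLipField h L where
  zero : ∀ t, h t 0 = 0

theorem IsPert.norm_le_mul {h : ℝ → E → E} {L : ℝ} (hh : IsPert h L) (t : ℝ) (x : E) :
    ‖h t x‖ ≤ L * ‖x‖ := by
  simpa [hh.zero] using hh.lip t x 0

theorem IsPert.rev {h : ℝ → E → E} {L : ℝ} (hh : IsPert h L) : IsPert (revPert h) L where
  meas x := (aestronglyMeasurable_comp_neg (hh.meas x)).neg
  lip t x y := by
    rw [revPert, revPert, ← neg_sub', norm_neg]
    exact hh.lip _ x y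
  nonneg := hh.nonneg
  bdd := ⟨0, fun t => by simp [revPert, hh.zero]⟩
  zero t := by simp [revPert, hh.zero]

theorem IsSolution.rev {M : ℝ → E →L[ℝ] E} {h : ℝ → E → E} {z : ℝ → E}
    (hz : IsSolution (field M h) z) :
    IsSolution (field (revMat M) (revPert h)) (fun t => z (-t)) :=
  hz.isPrimitive.comp_neg.congr fun t => by
    simp only [field, revPert, revMat_apply]
    abel

theorem revMat_revMat (M : ℝ → E →L[ℝ] E) : revMat (revMat M) = M := by
  funext t; simp [revMat]

theorem revPert_revPert (h : ℝ → E → E) : revPert (revPert h) = h := by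
  funext t x; simp [revPert]

theorem IsSolution.of_rev {M : ℝ → E →L[ℝ] E} {h : ℝ → E → E} {z : ℝ → E}
    (hz : IsSolution (field (revMat M) (revPert h)) z) :
    IsSolution (field M h) (fun t => z (-t)) := by
  have := hz.rev
  rwa [revMat_revMat, revPert_revPert] at this

/-- Boundedness for positive times. -/
def BddFuture (d : ℝ → E) : Prop := ∃ C, ∀ t, 0 ≤ t → ‖d t‖ ≤ C

theorem BddFuture.exists_bound {d : ℝ → E} (hd : BddFuture d) (hc : Continuous d) (τ : ℝ) :
    ∃ C, ∀ t, τ ≤ t → ‖d t‖ ≤ C := by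
  obtain ⟨C, hC⟩ := hd
  obtain ⟨C', hC'⟩ := hc.locBdd |τ|
  refine ⟨max C C', fun t ht => ?_⟩
  rcases le_total 0 t with h | h
  · exact (hC t h).trans (le_max_left _ _)
  · refine (hC' t ?_).trans (le_max_right _ _)
    rw [abs_of_nonpos h, abs_of_nonpos (ht.trans h)]
    linarith

theorem bddFuture_of_exists {d : ℝ → E} (hc : Continuous d) {τ : ℝ}
    (h : ∃ C, ∀ t, τ ≤ t → ‖d t‖ ≤ C) : BddFuture d := by
  obtain ⟨C, hC⟩ := h
  obtain ⟨C', hC'⟩ := hc.locBdd |τ|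
  refine ⟨max C C', fun t ht => ?_⟩
  rcases le_total τ t with h | h
  · exact (hC t h).trans (le_max_left _ _)
  · refine (hC' t ?_).trans (le_max_right _ _)
    rw [abs_of_nonneg ht, abs_of_nonneg (ht.trans h)]
    exact h

theorem BddFuture.add {d e : ℝ → E} (hd : BddFuture d) (he : BddFuture e) :
    BddFuture (fun t => d t + e t) := by
  obtain ⟨C, hC⟩ := hd
  obtain ⟨C', hC'⟩ := he
  exact ⟨C + C', fun t ht => (norm_add_le _ _).trans (add_le_add (hC t ht) (hC' t ht))⟩

theorem BddFuture.sub {d e : ℝ → E} (hd : BddFuture d) (he : BddFuture e) :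
    BddFuture (fun t => d t - e t) := by
  obtain ⟨C, hC⟩ := hd
  obtain ⟨C', hC'⟩ := he
  exact ⟨C + C', fun t ht => (norm_sub_le _ _).trans (add_le_add (hC t ht) (hC' t ht))⟩

theorem exists_bound_of_bddFuture {d : ℝ → E} (h₁ : BddFuture d)
    (h₂ : BddFuture fun t => d (-t)) : ∃ C, ∀ t, ‖d t‖ ≤ C := by
  obtain ⟨C, hC⟩ := h₁
  obtain ⟨C', hC'⟩ := h₂
  refine ⟨max C C', fun t => ?_⟩
  rcases le_total 0 t with h | h
  · exact (hC t h).trans (le_max_left _ _)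
  · have := hC' (-t) (by linarith)
    simp only [neg_neg] at this
    exact this.trans (le_max_right _ _)

variable {M : ℝ → E →L[ℝ] E} {Z : ℝ → ℝ → E →L[ℝ] E} {P : ℝ → E →L[ℝ] E} {K α β L : ℝ}
  {h : ℝ → E → E}

namespace ExpDichotomy

theorem isLipField_field (D : ExpDichotomy M Z P K α β) (hh : IsPert h L) :
    IsLipField (field M h) (β + L) where
  meas x := by
    have hap := (ContinuousLinearMap.apply ℝ E x).continuous.comp_aestronglyMeasurable D.meas
    exact hap.add (hh.meas x)
  lip t x y := by
    have e : field M h t x - field M h t y = M t (x - y) + (h t x - h t y) := by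
      rw [field, field, map_sub]; abel
    rw [e, add_mul]
    exact (norm_add_le _ _).trans
      (add_le_add ((M t).le_of_opNorm_le (D.norm_le t) _) (hh.lip t x y))
  nonneg := add_nonneg D.β_nonneg hh.nonneg
  bdd := ⟨0, fun t => by simp [field, hh.zero]⟩

theorem isSolution_zero (M : ℝ → E →L[ℝ] E) (hh : IsPert h L) :
    IsSolution (field M h) (fun _ => 0) := by
  have e : ∀ s, field M h s 0 = 0 := fun s => by simp [field, hh.zero]
  refine IsPrimitive.congr (k := fun _ => 0) ⟨locallyIntegrable_zero, fun a b => by simp⟩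
    fun s => (e s).symm

theorem isPrimitive_sub {z₁ z₂ : ℝ → E} (h₁ : IsSolution (field M h) z₁)
    (h₂ : IsSolution (field M h) z₂) :
    IsPrimitive (fun t => M t (z₁ t - z₂ t) + (h t (z₁ t) - h t (z₂ t)))
      (fun t => z₁ t - z₂ t) :=
  (h₁.isPrimitive.sub h₂.isPrimitive).congr fun t => by
    simp only [field, map_sub]
    abel

variable [CompleteSpace E]

/-- Expansivity. The difference is a bounded solution of a Lipschitz perturbation vanishing at 0, so
the a priori bound with κ = 0 annihilates it. All uniqueness of brackets and stable parts rests on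
this. -/
theorem eq_of_bdd (D : ExpDichotomy M Z P K α β) (hh : IsPert h L) (hL : 4 * K * L < α)
    {z₁ z₂ : ℝ → E} (h₁ : IsSolution (field M h) z₁) (h₂ : IsSolution (field M h) z₂)
    (hb : ∃ C, ∀ t, ‖z₁ t - z₂ t‖ ≤ C) : z₁ = z₂ := by
  obtain ⟨C, hC⟩ := hb
  have hKL : 0 ≤ K * L := mul_nonneg D.K_pos.le hh.nonneg
  funext t
  have := D.norm_le_of_bdd_lip (κ := 0) (by linarith) hh.nonneg
    ((hh.aestronglyMeasurable h₁.continuous).sub (hh.aestronglyMeasurable h₂.continuous))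
    (isPrimitive_sub h₁ h₂) (fun t => by simpa using hh.lip t _ _) hC t
  rw [mul_zero, zero_div] at this
  exact sub_eq_zero.mp (norm_le_zero_iff.mp this)

theorem norm_unstable_le (D : ExpDichotomy M Z P K α β) {t s : ℝ} (hts : t ≤ s) (x : E) :
    ‖Z t s (x - P s x)‖ ≤ K * ‖x‖ := by
  refine (D.unstable t s x hts).trans (mul_le_mul_of_nonneg_right ?_ (norm_nonneg _))
  refine mul_le_of_le_one_right D.K_pos.le (Real.exp_le_one_iff.mpr ?_)
  have := mul_nonneg D.pos.le (sub_nonneg.mpr hts)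
  linarith

theorem norm_stable_le (D : ExpDichotomy M Z P K α β) {t s : ℝ} (hts : s ≤ t) (x : E) :
    ‖Z t s (P s x)‖ ≤ K * ‖x‖ := by
  refine (D.stable t s x hts).trans (mul_le_mul_of_nonneg_right ?_ (norm_nonneg _))
  refine mul_le_of_le_one_right D.K_pos.le (Real.exp_le_one_iff.mpr ?_)
  have := mul_nonneg D.pos.le (sub_nonneg.mpr hts)
  linarith

/-- For a point `p` of the stable space at time `τ`, there is a solution of the perturbed
system, bounded in the future, whose stable component at time `τ` is `p`. -/
theorem exists_stable (D : ExpDichotomy M Z P K α β) (hh : IsPert h L) (hL : 4 * K * L < α)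
    (τ : ℝ) {p : E} (hp : P τ p = p) :
    ∃ a, IsSolution (field M h) a ∧ P τ (a τ) = p ∧ BddFuture a := by
  classical
  have hK := D.K_pos
  have hKL : 0 ≤ K * L := mul_nonneg D.K_pos.le hh.nonneg
  have hZp := D.sol_apply τ p
  -- The unknown is the correction `v` to the linear solution through `p`. The nonlinearity is
  -- switched off before τ, which keeps the forcing at v = 0 bounded, although Z(s,τ)p may blow up
  -- in the past.
  set k : ℝ → E → E := fun s v => if τ < s then h s (v + Z s τ p) else 0 with hk
  have hkl : IsLipField k L := by
    refine ⟨fun x => ?_, fun t x y => ?_, hh.nonneg, L * (K * ‖p‖), fun t => ?_⟩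
    · have h1 := hh.aestronglyMeasurable (continuous_const.add hZp.continuous :
        Continuous fun s => x + Z s τ p)
      exact (h1.indicator (measurableSet_Ioi (a := τ))).congr
        (Eventually.of_forall fun s => by simp [hk, indicator])
    · by_cases ht : τ < t
      · simpa [hk, ht] using hh.lip t (x + Z t τ p) (y + Z t τ p)
      · simp only [hk, ht, if_false, sub_self, norm_zero]
        exact mul_nonneg hh.nonneg (norm_nonneg _)
    · by_cases ht : τ < t
      · simp only [hk, ht, if_true, zero_add]
        refine (hh.norm_le_mul t _).trans (mul_le_mul_of_nonneg_left ?_ hh.nonneg)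
        have := D.norm_stable_le ht.le p
        rwa [hp] at this
      · simp only [hk, ht, if_false, norm_zero]
        exact mul_nonneg hh.nonneg (mul_nonneg hK.le (norm_nonneg _))
  obtain ⟨v, hv, C, hC⟩ := D.exists_bdd_lip (by linarith) hkl
  -- Up to time τ the correction is a bounded solution of the homogeneous linear system, so it has
  -- no stable component.
  have hP0 : P τ (v τ) = 0 := by
    have h1 := D.stableNorm_le_of_bdd (hkl.locBdd hv.continuous.locBdd)
      (hkl.aestronglyMeasurable hv.continuous) hv.isPrimitive (t := τ) (κ := 0) (C := C)
      (fun r hr => by simp [hk, not_lt.mpr hr]) (fun r _ => hC r)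
    rw [mul_zero, zero_div] at h1
    exact norm_le_zero_iff.mp ((D.norm_proj_le_stableNorm _ _).trans h1)
  have hF := D.isLipField_field hh
  -- The sum v + Z(·,τ)p solves the perturbed system only after τ; `a` is the genuine global
  -- solution that agrees with it there.
  obtain ⟨a, ha, haτ⟩ := hF.exists_solution τ (v τ + p)
  have hd := ((hv.isPrimitive.add hZp).sub ha.isPrimitive)
  have heq : ∀ t, τ ≤ t → a t = v t + Z t τ p := by
    intro t ht
    have := hd.gronwall hF.nonneg ht (fun r hr => by
      refine le_trans (le_of_eq ?_) (hF.lip r (v r + Z r τ p) (a r))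
      simp only [field, hk, hr.1, if_true, map_add]
      congr 1
      abel)
    rw [haτ, D.self, sub_self, norm_zero, zero_mul] at this
    exact (sub_eq_zero.mp (norm_le_zero_iff.mp this)).symm
  refine ⟨a, ha, by rw [haτ, map_add, hP0, hp, zero_add], ?_⟩
  refine bddFuture_of_exists ha.continuous (τ := τ) ⟨C + K * ‖p‖, fun t ht => ?_⟩
  rw [heq t ht]
  refine (norm_add_le _ _).trans (add_le_add (hC t) ?_)
  have := D.norm_stable_le ht p
  rwa [hp] at this

/-- Given two solutions `a`, `b` there is a solution asymptotic to `a` in the past and to `b` in the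
future, with uniform bounds. -/
theorem exists_bracket (D : ExpDichotomy M Z P K α β) (hh : IsPert h L) (hL : 4 * K * L < α)
    {a b : ℝ → E} (ha : IsSolution (field M h) a) (hb : IsSolution (field M h) b) (τ : ℝ) :
    ∃ z, IsSolution (field M h) z ∧ (∀ s, s ≤ τ → ‖z s - a s‖ ≤ 2 * K * ‖a τ - b τ‖) ∧
      ∀ s, τ ≤ s → ‖z s - b s‖ ≤ 2 * K * ‖a τ - b τ‖ := by
  classical
  have hK := D.K_pos
  have hKL : 0 ≤ K * L := mul_nonneg D.K_pos.le hh.nonneg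
  set J := a τ - b τ with hJ
  have hma := hh.aestronglyMeasurable ha.continuous
  have hmb := hh.aestronglyMeasurable hb.continuous
  -- The approximate bracket `c` is driven by the nonlinearity along `a` before τ and along `b`
  -- after τ. Thus c - a and c - b solve the homogeneous linear system on the respective half-lines.
  set l : ℝ → E := fun s => if s ≤ τ then h s (a s) else h s (b s) with hl
  have hlm : AEStronglyMeasurable l volume := by
    have := (hma.restrict (s := Iic τ)).piecewise (measurableSet_Iic (a := τ))
      (hmb.restrict (s := (Iic τ)ᶜ))
    refine this.congr (Eventually.of_forall fun s => ?_)
    simp [hl, piecewise]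
  have hlb : LocBdd l := by
    intro N
    obtain ⟨C, hC⟩ := hh.locBdd ha.continuous.locBdd N
    obtain ⟨C', hC'⟩ := hh.locBdd hb.continuous.locBdd N
    refine ⟨max C C', fun t ht => ?_⟩
    by_cases hs : t ≤ τ
    · simpa [hl, hs] using Or.inl (hC t ht)
    · simpa [hl, hs] using Or.inr (hC' t ht)
  -- With this choice c - a starts at τ in the unstable space and c - b in the stable space, so each
  -- stays bounded on its half-line by K times the jump.
  set c₀ := P τ (a τ) + (b τ - P τ (b τ)) with hc₀
  set c : ℝ → E := fun t => Z t τ c₀ + ∫ r in τ..t, Z t r (l r) with hc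
  have hcs : IsPrimitive (fun t => M t (c t) + l t) c := D.isPrimitive_variation hlb hlm τ c₀
  have hcτ : c τ = c₀ := by simp [hc, D.self]
  have hca : ∀ s, s ≤ τ → ‖c s - a s‖ ≤ K * ‖J‖ := by
    intro s hs
    have hd : IsPrimitive (fun t => M t (c t - a t) + (l t - h t (a t))) (fun t => c t - a t) :=
      (hcs.sub ha.isPrimitive).congr fun t => by
        simp only [field, map_sub]; abel
    have hbd : LocBdd (fun t => l t - h t (a t)) := by
      intro N
      obtain ⟨C, hC⟩ := hlb N
      obtain ⟨C', hC'⟩ := hh.locBdd ha.continuous.locBdd N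
      exact ⟨C + C', fun t ht => (norm_sub_le _ _).trans (add_le_add (hC t ht) (hC' t ht))⟩
    have hv := D.variation hbd (hlm.sub hma) hd τ s
    have hz : ∫ r in τ..s, Z s r (l r - h r (a r)) = 0 := by
      refine intervalIntegral.integral_zero_ae (Eventually.of_forall fun r hr => ?_)
      rw [uIoc_of_ge hs] at hr
      simp [hl, hr.2]
    rw [hz, add_zero, hcτ] at hv
    have e : c₀ - a τ = -(J - P τ J) := by
      rw [hc₀, hJ, map_sub]; abel
    rw [hv, e, map_neg, norm_neg]
    exact D.norm_unstable_le hs J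
  have hcb : ∀ s, τ ≤ s → ‖c s - b s‖ ≤ K * ‖J‖ := by
    intro s hs
    have hd : IsPrimitive (fun t => M t (c t - b t) + (l t - h t (b t))) (fun t => c t - b t) :=
      (hcs.sub hb.isPrimitive).congr fun t => by
        simp only [field, map_sub]; abel
    have hbd : LocBdd (fun t => l t - h t (b t)) := by
      intro N
      obtain ⟨C, hC⟩ := hlb N
      obtain ⟨C', hC'⟩ := hh.locBdd hb.continuous.locBdd N
      exact ⟨C + C', fun t ht => (norm_sub_le _ _).trans (add_le_add (hC t ht) (hC' t ht))⟩
    have hv := D.variation hbd (hlm.sub hmb) hd τ s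
    have hz : ∫ r in τ..s, Z s r (l r - h r (b r)) = 0 := by
      refine intervalIntegral.integral_zero_ae (Eventually.of_forall fun r hr => ?_)
      rw [uIoc_of_le hs] at hr
      simp [hl, not_le.mpr hr.1]
    rw [hz, add_zero, hcτ] at hv
    have e : c₀ - b τ = P τ J := by
      rw [hc₀, hJ, map_sub]; abel
    rw [hv, e]
    exact D.norm_stable_le hs J
  -- The remaining correction from `c` to a true solution. At v = 0 it is bounded by LK‖J‖, since
  -- `c` stays within K‖J‖ of `a` or `b`.
  set k : ℝ → E → E := fun s v => h s (c s + v) - l s with hk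
  have hk0 : ∀ t, ‖k t 0‖ ≤ L * (K * ‖J‖) := by
    intro t
    simp only [hk, add_zero]
    by_cases ht : t ≤ τ
    · simp only [hl, ht, if_true]
      exact (hh.lip t _ _).trans (mul_le_mul_of_nonneg_left (hca t ht) hh.nonneg)
    · simp only [hl, ht, if_false]
      exact (hh.lip t _ _).trans (mul_le_mul_of_nonneg_left (hcb t (not_le.mp ht).le) hh.nonneg)
  have hkl : IsLipField k L := by
    refine ⟨fun x => ?_, fun t x y => ?_, hh.nonneg, _, hk0⟩
    · exact (hh.aestronglyMeasurable (hcs.continuous.add continuous_const)).sub hlm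
    · simpa [hk] using hh.lip t (c t + x) (c t + y)
  obtain ⟨v, hv, C, hC⟩ := D.exists_bdd_lip (by linarith) hkl
  have hvb : ∀ t, ‖v t‖ ≤ K * ‖J‖ := by
    intro t
    have h1 := D.norm_le_of_bdd_lip (by linarith) hh.nonneg (hkl.aestronglyMeasurable hv.continuous)
      hv.isPrimitive (fun t => hkl.norm_le hk0 t _) hC t
    refine h1.trans ?_
    rw [div_le_iff₀ (by linarith)]
    have h2 : 0 ≤ K * ‖J‖ := mul_nonneg hK.le (norm_nonneg _)
    -- Here 4KL < α makes the correction no larger than the error K‖J‖ of `c`; this gives the total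
    -- constant 2K.
    have h3 : 2 * K * L ≤ α - 2 * K * L := by linarith
    calc 2 * K * (L * (K * ‖J‖)) = K * ‖J‖ * (2 * K * L) := by ring
      _ ≤ _ := mul_le_mul_of_nonneg_left h3 h2
  refine ⟨fun t => c t + v t, (hcs.add hv.isPrimitive).congr fun t => ?_, fun s hs => ?_,
    fun s hs => ?_⟩
  · simp only [field, hk, map_add]
    abel
  · rw [add_sub_right_comm]
    refine (norm_add_le _ _).trans ((add_le_add (hca s hs) (hvb s)).trans (le_of_eq (by ring)))
  · rw [add_sub_right_comm]
    refine (norm_add_le _ _).trans ((add_le_add (hcb s hs) (hvb s)).trans (le_of_eq (by ring)))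

/-- The bounds of `exists_bracket` hold for every solution with the same asymptotics. -/
theorem bracket_bound (D : ExpDichotomy M Z P K α β) (hh : IsPert h L) (hL : 4 * K * L < α)
    {a b z : ℝ → E} (ha : IsSolution (field M h) a) (hb : IsSolution (field M h) b)
    (hz : IsSolution (field M h) z) (hza : BddFuture fun t => z (-t) - a (-t))
    (hzb : BddFuture fun t => z t - b t) (τ : ℝ) :
    (∀ s, s ≤ τ → ‖z s - a s‖ ≤ 2 * K * ‖a τ - b τ‖) ∧
      ∀ s, τ ≤ s → ‖z s - b s‖ ≤ 2 * K * ‖a τ - b τ‖ := by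
  obtain ⟨z', hz', h1, h2⟩ := D.exists_bracket hh hL ha hb τ
  have hzc := hz.continuous
  have hzc' := hz'.continuous
  have hac := ha.continuous
  have hbc := hb.continuous
  have e : z = z' := by
    refine D.eq_of_bdd hh hL hz hz' (exists_bound_of_bddFuture ?_ ?_)
    · have h3 : BddFuture fun t => z' t - b t :=
        bddFuture_of_exists (hzc'.sub hbc) ⟨_, h2⟩
      simpa using hzb.sub h3
    · have h3 : BddFuture fun t => z' (-t) - a (-t) :=
        bddFuture_of_exists (τ := -τ) (by fun_prop) ⟨_, fun t ht => h1 (-t) (by linarith)⟩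
      simpa using hza.sub h3
  rw [e]
  exact ⟨h1, h2⟩

/-- Differences of solutions that are bounded in the future lie in the stable cone, where the stable
seminorm decreases. -/
theorem cone (D : ExpDichotomy M Z P K α β) (hh : IsPert h L) (hL : 4 * K * L < α)
    {z₁ z₂ : ℝ → E} (h₁ : IsSolution (field M h) z₁) (h₂ : IsSolution (field M h) z₂)
    (hb : BddFuture fun t => z₁ t - z₂ t) (τ : ℝ) :
    unstableNorm Z P α τ (z₁ τ - z₂ τ) ≤ stableNorm Z P α τ (z₁ τ - z₂ τ) ∧
    ∀ t, τ ≤ t → stableNorm Z P α t (z₁ t - z₂ t) ≤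
      (1 + Real.exp (-α * (t - τ))) / 2 * stableNorm Z P α τ (z₁ τ - z₂ τ) := by
  obtain ⟨C, hC⟩ := hb.exists_bound (h₁.continuous.sub h₂.continuous) τ
  have hK := D.K_pos
  have hα := D.pos
  have hd := isPrimitive_sub h₁ h₂
  have hkm := (hh.aestronglyMeasurable h₁.continuous).sub (hh.aestronglyMeasurable h₂.continuous)
  have hkb : LocBdd (fun t => h t (z₁ t) - h t (z₂ t)) := by
    intro N
    obtain ⟨C, hC⟩ := hh.locBdd h₁.continuous.locBdd N
    obtain ⟨C', hC'⟩ := hh.locBdd h₂.continuous.locBdd N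
    exact ⟨C + C', fun t ht => (norm_sub_le _ _).trans (add_le_add (hC t ht) (hC' t ht))⟩
  set u : ℝ → ℝ := fun t => stableNorm Z P α t (z₁ t - z₂ t) with hu
  set w : ℝ → ℝ := fun t => unstableNorm Z P α t (z₁ t - z₂ t) with hw
  have hu0 : ∀ t, 0 ≤ u t := fun t => D.stableNorm_nonneg _ _
  have hub : BddAbove (range fun t : Ici τ => u t) := by
    refine ⟨K * C, ?_⟩
    rintro _ ⟨t, rfl⟩
    exact (D.stableNorm_le_norm _ _).trans (mul_le_mul_of_nonneg_left (hC t t.2) hK.le)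
  have hwb : BddAbove (range fun t : Ici τ => w t) := by
    refine ⟨K * C, ?_⟩
    rintro _ ⟨t, rfl⟩
    exact (D.rev.stableNorm_le_norm _ _).trans (mul_le_mul_of_nonneg_left (hC t t.2) hK.le)
  set S := ⨆ t : Ici τ, u t with hS
  set W := ⨆ t : Ici τ, w t with hW
  have hlS : ∀ t, τ ≤ t → u t ≤ S := fun t ht => le_ciSup hub ⟨t, ht⟩
  have hlW : ∀ t, τ ≤ t → w t ≤ W := fun t ht => le_ciSup hwb ⟨t, ht⟩
  have hS0 : 0 ≤ S := (hu0 τ).trans (hlS τ le_rfl)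
  have hW0 : 0 ≤ W := (D.rev.stableNorm_nonneg _ _).trans (hlW τ le_rfl)
  have hκ : ∀ r, τ ≤ r → ‖h r (z₁ r) - h r (z₂ r)‖ ≤ L * (S + W) := fun r hr =>
    (hh.lip r _ _).trans (mul_le_mul_of_nonneg_left
      ((D.norm_le_add r _).trans (add_le_add (hlS r hr) (hlW r hr))) hh.nonneg)
  -- The factor 1/4 comes from 4KL < α. Applied to the unstable component it gives W ≤ S/3; fed back
  -- into the stable component, it shows that the supremum S is attained at τ.
  have hq : K * (L * (S + W)) / α ≤ (S + W) / 4 := by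
    rw [div_le_div_iff₀ hα (by norm_num)]
    have := mul_le_mul_of_nonneg_right hL.le (add_nonneg hS0 hW0)
    nlinarith
  have hW1 : W ≤ (S + W) / 4 := by
    have : Nonempty (Ici τ) := ⟨⟨τ, mem_Ici.mpr le_rfl⟩⟩
    refine ciSup_le fun t => ?_
    refine (D.unstableNorm_le_of_bdd hkb hkm hd (t := t) (κ := L * (S + W)) (C := C)
      (fun r hr => hκ r (t.2.trans hr)) (fun r hr => hC r (t.2.trans hr))).trans hq
  have hW3 : W ≤ S / 3 := by linarith
  have hstep : ∀ t, τ ≤ t → u t ≤ Real.exp (-α * (t - τ)) * u τ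
      + S / 3 * (1 - Real.exp (-α * (t - τ))) := by
    intro t ht
    refine (D.stableNorm_variation_le hkb hkm hd ht fun r hr => hκ r hr.1).trans ?_
    have h1 : Real.exp (-α * (t - τ)) ≤ 1 := Real.exp_le_one_iff.mpr (by
      have := mul_nonneg hα.le (sub_nonneg.mpr ht)
      linarith)
    have h2 : K * (L * (S + W)) / α ≤ S / 3 := by linarith
    have h3 := mul_le_mul_of_nonneg_right h2 (sub_nonneg.mpr h1)
    linarith
  have hSu : S ≤ u τ := by
    have : Nonempty (Ici τ) := ⟨⟨τ, mem_Ici.mpr le_rfl⟩⟩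
    have h1 : S ≤ max (u τ) (S / 3) := by
      refine ciSup_le fun t => (hstep t t.2).trans ?_
      have h1 : Real.exp (-α * (t - τ)) ≤ 1 := Real.exp_le_one_iff.mpr (by
        have := mul_nonneg hα.le (sub_nonneg.mpr (show τ ≤ (t : ℝ) from t.2))
        linarith)
      have h2 := (Real.exp_pos (-α * (t - τ))).le
      have h3 := mul_le_mul_of_nonneg_left (le_max_left (u τ) (S / 3)) h2
      have h4 := mul_le_mul_of_nonneg_right (le_max_right (u τ) (S / 3)) (sub_nonneg.mpr h1)
      linarith
    rcases le_max_iff.mp h1 with h2 | h2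
    · exact h2
    · have := hu0 τ
      linarith
  refine ⟨?_, fun t ht => ?_⟩
  · have := hlW τ le_rfl
    change w τ ≤ u τ
    linarith
  · refine (hstep t ht).trans ?_
    have h1 : Real.exp (-α * (t - τ)) ≤ 1 := Real.exp_le_one_iff.mpr (by
      have := mul_nonneg hα.le (sub_nonneg.mpr ht)
      linarith)
    change _ ≤ _ * u τ
    -- The bound 1/3 is relaxed to 1/2 to obtain the symmetric factor (1 + e^{-α(t-τ)})/2,
    -- convenient for iteration.
    have h3 : S / 3 ≤ u τ / 2 := by have := hu0 τ; linarith
    have h4 := mul_le_mul_of_nonneg_right h3 (sub_nonneg.mpr h1)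
    linarith

/-- Iterating over n + 1 equal steps δ and letting n tend to infinity turns the factor (1 +
e^{-αδ})/2 into the rate α/2, with no multiplicative constant. That constant 1 is what makes the
seminorm strictly decreasing along stable solutions. -/
theorem le_exp_of_forall_le {u : ℝ → ℝ} (hα : 0 < α) (hu : ∀ t, 0 ≤ u t)
    (h : ∀ s t, s ≤ t → u t ≤ (1 + Real.exp (-α * (t - s))) / 2 * u s) {s t : ℝ} (hst : s ≤ t) :
    u t ≤ Real.exp (-(α / 2) * (t - s)) * u s := by
  set x := α * (t - s) with hx
  have hn : ∀ n : ℕ, u t ≤ Real.exp (-x / 2 + x ^ 2 / 8 * (1 / ((n : ℝ) + 1))) * u s := by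
    intro n
    have hN : (0 : ℝ) < (n : ℝ) + 1 := by positivity
    set δ := (t - s) / ((n : ℝ) + 1) with hδ
    have hδ0 : 0 ≤ δ := div_nonneg (sub_nonneg.mpr hst) hN.le
    set q := (1 + Real.exp (-α * δ)) / 2 with hq
    have hq0 : 0 ≤ q := by positivity
    have hj : ∀ j : ℕ, u (s + j * δ) ≤ q ^ j * u s := by
      intro j
      induction j with
      | zero => simp
      | succ j ih =>
        have h1 := h (s + j * δ) (s + (j + 1 : ℕ) * δ) (by push_cast; linarith)
        rw [show s + ((j + 1 : ℕ) : ℝ) * δ - (s + j * δ) = δ by push_cast; ring] at h1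
        refine h1.trans ?_
        rw [pow_succ', mul_assoc]
        exact mul_le_mul_of_nonneg_left ih hq0
    have h2 := hj (n + 1)
    rw [show s + ((n + 1 : ℕ) : ℝ) * δ = t by rw [hδ]; push_cast; field_simp; ring] at h2
    refine h2.trans (mul_le_mul_of_nonneg_right ?_ (hu s))
    -- (1 + e^{-x})/2 = e^{-x/2} cosh(x/2) and cosh y ≤ e^{y²/2}; the quadratic errors sum to
    -- O(1/(n+1)).
    have hqe : q ≤ Real.exp (-(α * δ) / 2 + (α * δ / 2) ^ 2 / 2) := by
      have h3 := Real.cosh_le_exp_half_sq (α * δ / 2)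
      have h4 : q = Real.exp (-(α * δ) / 2) * Real.cosh (α * δ / 2) := by
        have e1 : Real.exp (-(α * δ) / 2) * Real.exp (α * δ / 2) = 1 := by
          rw [← Real.exp_add, show -(α * δ) / 2 + α * δ / 2 = 0 by ring, Real.exp_zero]
        have e2 : Real.exp (-(α * δ) / 2) * Real.exp (-(α * δ / 2)) = Real.exp (-α * δ) := by
          rw [← Real.exp_add, show -(α * δ) / 2 + -(α * δ / 2) = -α * δ by ring]
        rw [Real.cosh_eq, hq, ← e2, ← e1]
        ring
      rw [h4, Real.exp_add]
      exact mul_le_mul_of_nonneg_left h3 (Real.exp_pos _).le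
    refine (pow_le_pow_left₀ hq0 hqe _).trans (le_of_eq ?_)
    rw [← Real.exp_nat_mul]
    congr 1
    rw [hδ, hx]
    push_cast
    field_simp
    ring
  have hlim : Tendsto (fun n : ℕ => Real.exp (-x / 2 + x ^ 2 / 8 * (1 / ((n : ℝ) + 1))) * u s) atTop
      (𝓝 (Real.exp (-x / 2 + x ^ 2 / 8 * 0) * u s)) := by
    refine Tendsto.mul_const _ ((Real.continuous_exp.tendsto _).comp ?_)
    exact (tendsto_one_div_add_atTop_nhds_zero_nat.const_mul _).const_add _
  have := ge_of_tendsto' hlim hn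
  rwa [mul_zero, add_zero, show -x / 2 = -(α / 2) * (t - s) by rw [hx]; ring] at this

end ExpDichotomy

end Perturbation

/-! ### Stable manifolds, crossing times and the matching of stable solutions. -/

section Matching

set_option linter.unusedSectionVars false

variable {E : Type*} [NormedAddCommGroup E] [NormedSpace ℝ E]

/-- Solutions of the perturbed system on the stable manifold of the zero solution. -/
def StableSol (M : ℝ → E →L[ℝ] E) (h : ℝ → E → E) (a : ℝ → E) : Prop :=
  IsSolution (field M h) a ∧ BddFuture a

/-- Two solution curves are matched if both vanish or if they have the same stable component at the
time when it crosses the unit sphere of the adapted norm. -/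
def Matched (Z : ℝ → ℝ → E →L[ℝ] E) (P : ℝ → E →L[ℝ] E) (α : ℝ) (a₁ a₂ : ℝ → E) : Prop :=
  (a₁ = 0 ∧ a₂ = 0) ∨ ∃ T, stableNorm Z P α T (a₁ T) = 1 ∧ P T (a₁ T) = P T (a₂ T)

variable {M : ℝ → E →L[ℝ] E} {Z : ℝ → ℝ → E →L[ℝ] E} {P : ℝ → E →L[ℝ] E} {K α β L : ℝ}
  {h h₁ h₂ : ℝ → E → E} {L₁ L₂ : ℝ}

theorem Matched.symm {a₁ a₂ : ℝ → E} (hm : Matched Z P α a₁ a₂) : Matched Z P α a₂ a₁ := by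
  rcases hm with hm | ⟨T, h1, h2⟩
  · exact Or.inl hm.symm
  · exact Or.inr ⟨T, by rwa [← ExpDichotomy.stableNorm_eq_of_proj_eq h2], h2.symm⟩

namespace ExpDichotomy

variable [CompleteSpace E]

theorem continuous_stableNorm_comp (D : ExpDichotomy M Z P K α β) {a : ℝ → E} (ha : Continuous a) :
    Continuous fun t => stableNorm Z P α t (a t) :=
  D.continuous_stableNorm.comp (continuous_id.prodMk ha)

/-- By the cone estimate the stable component controls the unstable one, so the stable manifold is a
graph over the range of the projection. -/
theorem stableSol_unique (D : ExpDichotomy M Z P K α β) (hh : IsPert h L) (hL : 4 * K * L < α)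
    {a₁ a₂ : ℝ → E} (h₁ : StableSol M h a₁) (h₂ : StableSol M h a₂) {τ : ℝ}
    (hp : P τ (a₁ τ) = P τ (a₂ τ)) : a₁ = a₂ := by
  obtain ⟨h1, -⟩ := D.cone hh hL h₁.1 h₂.1 (h₁.2.sub h₂.2) τ
  have h2 : stableNorm Z P α τ (a₁ τ - a₂ τ) = 0 := by
    rw [stableNorm_eq_of_proj_eq (y := 0) (by rw [map_sub, hp, sub_self, map_zero])]
    refine le_antisymm ?_ (D.stableNorm_nonneg _ _)
    simpa using D.stableNorm_le_norm τ (0 : E)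
  have h3 := D.norm_le_add τ (a₁ τ - a₂ τ)
  refine (D.isLipField_field hh).eq_of_eq h₁.1 h₂.1 (s := τ) ?_
  refine sub_eq_zero.mp (norm_le_zero_iff.mp ?_)
  linarith

theorem stableSol_cone (D : ExpDichotomy M Z P K α β) (hh : IsPert h L) (hL : 4 * K * L < α)
    {a : ℝ → E} (ha : StableSol M h a) (t : ℝ) : ‖a t‖ ≤ 2 * stableNorm Z P α t (a t) := by
  obtain ⟨h1, -⟩ := D.cone hh hL ha.1 (isSolution_zero M hh) (by simpa using ha.2) t
  rw [sub_zero] at h1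
  have := D.norm_le_add t (a t)
  linarith

theorem stableSol_decay (D : ExpDichotomy M Z P K α β) (hh : IsPert h L) (hL : 4 * K * L < α)
    {a : ℝ → E} (ha : StableSol M h a) {s t : ℝ} (hst : s ≤ t) :
    stableNorm Z P α t (a t) ≤ Real.exp (-(α / 2) * (t - s)) * stableNorm Z P α s (a s) := by
  refine le_exp_of_forall_le (u := fun t => stableNorm Z P α t (a t)) D.pos
    (fun t => D.stableNorm_nonneg _ _) (fun s t hst => ?_) hst
  obtain ⟨-, h2⟩ := D.cone hh hL ha.1 (isSolution_zero M hh) (by simpa using ha.2) s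
  simpa using h2 t hst

/-- A Lipschitz bound on how fast a stable solution can grow backwards. It shows that a long
distance to the crossing time is the only way to be very small. -/
theorem stableSol_growth (D : ExpDichotomy M Z P K α β) (hh : IsPert h L) (hL : 4 * K * L < α)
    {a : ℝ → E} (ha : StableSol M h a) {s t : ℝ} (hst : s ≤ t) :
    stableNorm Z P α s (a s) ≤ 2 * K * Real.exp ((β + L) * (t - s)) * stableNorm Z P α t (a t) := by
  have h1 := (D.isLipField_field hh).norm_sub_le ha.1 (isSolution_zero M hh) t s
  rw [sub_zero, sub_zero, abs_of_nonpos (by linarith), neg_sub] at h1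
  have h2 := D.stableNorm_le_norm s (a s)
  have h3 := D.stableSol_cone hh hL ha t
  have h4 := mul_le_mul_of_nonneg_right h3 (Real.exp_pos ((β + L) * (t - s))).le
  have h5 := mul_le_mul_of_nonneg_left (h1.trans h4) D.K_pos.le
  linarith

theorem stableSol_bound (D : ExpDichotomy M Z P K α β) (hh : IsPert h L) (hL : 4 * K * L < α)
    {a : ℝ → E} (ha : StableSol M h a) {s t : ℝ} (hst : s ≤ t) : ‖a t‖ ≤ 2 * K * ‖a s‖ := by
  have h1 := D.stableSol_cone hh hL ha t
  have h2 := D.stableSol_decay hh hL ha hst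
  have h3 := D.stableNorm_le_norm s (a s)
  have h4 : Real.exp (-(α / 2) * (t - s)) ≤ 1 := Real.exp_le_one_iff.mpr (by
    have := mul_nonneg D.pos.le (sub_nonneg.mpr hst)
    linarith)
  have h5 := mul_le_mul_of_nonneg_right h4 (D.stableNorm_nonneg s (a s))
  linarith

theorem stableNorm_pos (D : ExpDichotomy M Z P K α β) (hh : IsPert h L) (hL : 4 * K * L < α)
    {a : ℝ → E} (ha : StableSol M h a) (hne : a ≠ 0) (t : ℝ) : 0 < stableNorm Z P α t (a t) := by
  refine lt_of_le_of_ne (D.stableNorm_nonneg _ _) fun h0 => hne ?_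
  have h1 := D.stableSol_cone hh hL ha t
  rw [← h0, mul_zero] at h1
  exact (D.isLipField_field hh).eq_of_eq ha.1 (isSolution_zero M hh) (s := t)
    (norm_le_zero_iff.mp h1)

theorem stableNorm_strictAnti (D : ExpDichotomy M Z P K α β) (hh : IsPert h L)
    (hL : 4 * K * L < α) {a : ℝ → E} (ha : StableSol M h a) (hne : a ≠ 0) :
    StrictAnti fun t => stableNorm Z P α t (a t) := by
  intro s t hst
  refine (D.stableSol_decay hh hL ha hst.le).trans_lt ?_
  refine mul_lt_of_lt_one_left (D.stableNorm_pos hh hL ha hne s) (Real.exp_lt_one_iff.mpr ?_)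
  have := mul_pos D.pos (sub_pos.mpr hst)
  linarith

/-- Forward decay at rate α/2 makes the seminorm small in the future and, read backwards, large in
the past; the intermediate value theorem applies. -/
theorem exists_crossing (D : ExpDichotomy M Z P K α β) (hh : IsPert h L) (hL : 4 * K * L < α)
    {a : ℝ → E} (ha : StableSol M h a) (hne : a ≠ 0) :
    ∃ T, stableNorm Z P α T (a T) = 1 := by
  have hα := D.pos
  set u : ℝ → ℝ := fun t => stableNorm Z P α t (a t) with hu
  have hu0 : 0 < u 0 := D.stableNorm_pos hh hL ha hne 0
  have hc : Continuous u := D.continuous_stableNorm_comp ha.1.continuous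
  have hlim : Tendsto (fun t => Real.exp (-(α / 2) * t)) atTop (𝓝 0) :=
    Real.tendsto_exp_atBot.comp (tendsto_id.const_mul_atTop_of_neg (by linarith))
  have l1 : ∀ᶠ t in atTop, Real.exp (-(α / 2) * t) * u 0 < 1 := by
    have := hlim.mul_const (u 0)
    rw [zero_mul] at this
    exact this.eventually (gt_mem_nhds one_pos)
  have l2 : ∀ᶠ t in atTop, Real.exp (-(α / 2) * t) < u 0 := hlim.eventually (gt_mem_nhds hu0)
  obtain ⟨t, ht1, ht2, ht0⟩ := (l1.and (l2.and (eventually_ge_atTop 0))).exists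
  have h1 : u t ≤ 1 := by
    have := D.stableSol_decay hh hL ha ht0
    rw [sub_zero] at this
    exact this.trans ht1.le
  have h2 : 1 ≤ u (-t) := by
    have h3 := D.stableSol_decay hh hL ha (s := -t) (t := 0) (by linarith)
    rw [sub_neg_eq_add, zero_add] at h3
    by_contra hlt
    rw [not_le] at hlt
    have h4 := mul_lt_mul_of_pos_left hlt (Real.exp_pos (-(α / 2) * t))
    rw [mul_one] at h4
    exact absurd (h3.trans_lt (h4.trans ht2)) (lt_irrefl _)
  obtain ⟨T, hT⟩ := mem_range_of_exists_le_of_exists_ge hc ⟨t, h1⟩ ⟨-t, h2⟩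
  exact ⟨T, hT⟩

theorem exists_matched (D : ExpDichotomy M Z P K α β) (hh₁ : IsPert h₁ L₁) (hL₁ : 4 * K * L₁ < α)
    (hh₂ : IsPert h₂ L₂) (hL₂ : 4 * K * L₂ < α) {a₁ : ℝ → E} (ha₁ : StableSol M h₁ a₁) :
    ∃ a₂, StableSol M h₂ a₂ ∧ Matched Z P α a₁ a₂ := by
  by_cases hne : a₁ = 0
  · exact ⟨0, ⟨isSolution_zero M hh₂, 0, fun t _ => by simp⟩, Or.inl ⟨hne, rfl⟩⟩
  · obtain ⟨T, hT⟩ := D.exists_crossing hh₁ hL₁ ha₁ hne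
    obtain ⟨a₂, h1, h2, h3⟩ := D.exists_stable hh₂ hL₂ T (p := P T (a₁ T)) (D.proj T _)
    exact ⟨a₂, ⟨h1, h3⟩, Or.inr ⟨T, hT, h2.symm⟩⟩

theorem ne_zero_of_stableNorm_eq_one (D : ExpDichotomy M Z P K α β) {a : ℝ → E} {T : ℝ}
    (hT : stableNorm Z P α T (a T) = 1) : a ≠ 0 := by
  rintro rfl
  have := D.stableNorm_le_norm T (0 : E)
  rw [norm_zero, mul_zero] at this
  change stableNorm Z P α T 0 = 1 at hT
  linarith

theorem matched_unique (D : ExpDichotomy M Z P K α β) (hh₁ : IsPert h₁ L₁) (hL₁ : 4 * K * L₁ < α)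
    (hh₂ : IsPert h₂ L₂) (hL₂ : 4 * K * L₂ < α) {a₁ a₂ a₂' : ℝ → E} (ha₁ : StableSol M h₁ a₁)
    (ha₂ : StableSol M h₂ a₂) (ha₂' : StableSol M h₂ a₂') (hm : Matched Z P α a₁ a₂)
    (hm' : Matched Z P α a₁ a₂') : a₂ = a₂' := by
  rcases hm with ⟨h1, h2⟩ | ⟨T, h1, h2⟩
  · rcases hm' with ⟨-, h4⟩ | ⟨T', h3, -⟩
    · rw [h2, h4]
    · exact absurd h1 (D.ne_zero_of_stableNorm_eq_one h3)
  · have hne := D.ne_zero_of_stableNorm_eq_one h1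
    rcases hm' with ⟨h3, -⟩ | ⟨T', h3, h4⟩
    · exact absurd h3 hne
    · have hTT : T = T' := (D.stableNorm_strictAnti hh₁ hL₁ ha₁ hne).injective (h1.trans h3.symm)
      subst hTT
      exact D.stableSol_unique hh₂ hL₂ ha₂ ha₂' (h2.symm.trans h4)

/-- Matched solutions are uniformly comparable. -/
theorem matched_bound (D : ExpDichotomy M Z P K α β) (hh₁ : IsPert h₁ L₁) (hL₁ : 4 * K * L₁ < α)
    (hh₂ : IsPert h₂ L₂) (hL₂ : 4 * K * L₂ < α) (R : ℝ) :
    ∃ r, ∀ (a₁ a₂ : ℝ → E) (τ : ℝ), StableSol M h₁ a₁ → StableSol M h₂ a₂ → Matched Z P α a₁ a₂ →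
      ‖a₁ τ‖ ≤ R → ‖a₂ τ‖ ≤ r := by
  have hK := D.K_pos
  have hα := D.pos
  have hβL : 0 ≤ β + L₂ := add_nonneg D.β_nonneg hh₂.nonneg
  -- Bound for the time from τ to a later crossing: decay of `a₁` gives e^{α(T-τ)/2} ≤ KR, and x + 1
  -- ≤ e^x gives T - τ ≤ N. Within that time `a₂` grows backwards by a controlled factor from
  -- seminorm 1.
  set N := 2 * (K * R) / α with hN
  refine ⟨max 2 (2 * (2 * K * Real.exp ((β + L₂) * N))), fun a₁ a₂ τ ha₁ ha₂ hm hR => ?_⟩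
  have hc := D.stableSol_cone hh₂ hL₂ ha₂ τ
  rcases hm with ⟨-, h2⟩ | ⟨T, h1, h2⟩
  · refine le_max_of_le_left ?_
    rw [h2]
    simp
  · have h1' : stableNorm Z P α T (a₂ T) = 1 := by rwa [← stableNorm_eq_of_proj_eq h2]
    rcases le_total T τ with hT | hT
    · refine le_max_of_le_left (hc.trans ?_)
      have h3 := D.stableSol_decay hh₂ hL₂ ha₂ hT
      rw [h1', mul_one] at h3
      have h4 : Real.exp (-(α / 2) * (τ - T)) ≤ 1 := Real.exp_le_one_iff.mpr (by
        have := mul_nonneg hα.le (sub_nonneg.mpr hT)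
        linarith)
      linarith
    · refine le_max_of_le_right (hc.trans (mul_le_mul_of_nonneg_left ?_ zero_le_two))
      have h3 := D.stableSol_decay hh₁ hL₁ ha₁ hT
      have h4 := D.stableSol_growth hh₂ hL₂ ha₂ hT
      rw [h1', mul_one] at h4
      have h5 : T - τ ≤ N := by
        have h6 : stableNorm Z P α τ (a₁ τ) ≤ K * R :=
          (D.stableNorm_le_norm _ _).trans (mul_le_mul_of_nonneg_left hR hK.le)
        rw [h1] at h3
        have h7 : Real.exp (α / 2 * (T - τ)) ≤ K * R := by
          have h8 := h3.trans (mul_le_mul_of_nonneg_left h6 (Real.exp_pos _).le)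
          rw [neg_mul, Real.exp_neg, ← div_eq_inv_mul, le_div_iff₀ (Real.exp_pos _), one_mul] at h8
          exact h8
        have h9 := Real.add_one_le_exp (α / 2 * (T - τ))
        rw [hN, le_div_iff₀ hα]
        nlinarith
      refine h4.trans (mul_le_mul_of_nonneg_left (Real.exp_le_exp.mpr ?_) (by positivity))
      exact mul_le_mul_of_nonneg_left h5 hβL

/-- Matched solutions are simultaneously small. -/
theorem matched_small (D : ExpDichotomy M Z P K α β) (hh₁ : IsPert h₁ L₁) (hL₁ : 4 * K * L₁ < α)
    (hh₂ : IsPert h₂ L₂) (hL₂ : 4 * K * L₂ < α) {ε : ℝ} (hε : 0 < ε) :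
    ∃ δ > 0, ∀ (a₁ a₂ : ℝ → E) (τ : ℝ), StableSol M h₁ a₁ → StableSol M h₂ a₂ →
      Matched Z P α a₁ a₂ → ‖a₁ τ‖ < δ → ‖a₂ τ‖ < ε := by
  have hK := D.K_pos
  have hα := D.pos
  have hβL : 0 ≤ β + L₁ := add_nonneg D.β_nonneg hh₁.nonneg
  have hlim : Tendsto (fun t => 2 * Real.exp (-(α / 2) * t)) atTop (𝓝 (2 * 0)) :=
    (Real.tendsto_exp_atBot.comp (tendsto_id.const_mul_atTop_of_neg (by linarith))).const_mul 2
  rw [mul_zero] at hlim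
  -- Once a time `N` has elapsed since the crossing, `a₂` has norm below ε. If `a₁` has norm below
  -- 1/B, the growth bound forces the crossing to be at least that far in the past.
  obtain ⟨N, hN, hN0⟩ := ((hlim.eventually (gt_mem_nhds hε)).and (eventually_ge_atTop 0)).exists
  set B := 2 * K * Real.exp ((β + L₁) * N) * K with hB
  have hB0 : 0 < B := by positivity
  refine ⟨1 / B, by positivity, fun a₁ a₂ τ ha₁ ha₂ hm hR => ?_⟩
  rcases hm with ⟨-, h2⟩ | ⟨T, h1, h2⟩
  · rw [h2]
    simpa using hε
  · have h1' : stableNorm Z P α T (a₂ T) = 1 := by rwa [← stableNorm_eq_of_proj_eq h2]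
    rw [lt_div_iff₀ hB0] at hR
    have hu := D.stableNorm_le_norm τ (a₁ τ)
    have hNT : N ≤ τ - T := by
      by_contra hlt
      rw [not_le] at hlt
      have h3 : 1 ≤ 2 * K * Real.exp ((β + L₁) * N) * stableNorm Z P α τ (a₁ τ) := by
        rcases le_total T τ with hT | hT
        · have h4 := D.stableSol_growth hh₁ hL₁ ha₁ hT
          rw [h1] at h4
          refine h4.trans (mul_le_mul_of_nonneg_right ?_ (D.stableNorm_nonneg _ _))
          refine mul_le_mul_of_nonneg_left (Real.exp_le_exp.mpr ?_) (by positivity)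
          exact mul_le_mul_of_nonneg_left hlt.le hβL
        · have h4 := D.stableSol_decay hh₁ hL₁ ha₁ hT
          rw [h1] at h4
          refine h4.trans (mul_le_mul_of_nonneg_right ?_ (D.stableNorm_nonneg _ _))
          have h5 : Real.exp (-(α / 2) * (T - τ)) ≤ 1 := Real.exp_le_one_iff.mpr (by
            have := mul_nonneg hα.le (sub_nonneg.mpr hT)
            linarith)
          have h6 : 1 ≤ Real.exp ((β + L₁) * N) := Real.one_le_exp (mul_nonneg hβL hN0)
          have := D.one_le
          nlinarith
      have h7 := mul_le_mul_of_nonneg_left hu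
        (show 0 ≤ 2 * K * Real.exp ((β + L₁) * N) by positivity)
      rw [hB] at hR
      nlinarith
    have hT : T ≤ τ := by linarith
    have h8 := D.stableSol_decay hh₂ hL₂ ha₂ hT
    rw [h1', mul_one] at h8
    have h9 := D.stableSol_cone hh₂ hL₂ ha₂ τ
    have h10 : Real.exp (-(α / 2) * (τ - T)) ≤ Real.exp (-(α / 2) * N) := by
      refine Real.exp_le_exp.mpr ?_
      have := mul_le_mul_of_nonneg_left hNT hα.le
      linarith
    linarith

end ExpDichotomy

/-! ### Continuity of brackets, crossing times and the matching. -/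

section Limits

variable {ι : Type*}

theorem IsLipField.tendsto_solution {F : ℝ → E → E} {Λ : ℝ} (hF : IsLipField F Λ) {l : Filter ι}
    {z : ι → ℝ → E} {z₀ : ℝ → E} {s t : ι → ℝ} {s₀ t₀ : ℝ} (hz : ∀ i, IsSolution F (z i))
    (hz₀ : IsSolution F z₀) (hs : Tendsto s l (𝓝 s₀)) (ht : Tendsto t l (𝓝 t₀))
    (h : Tendsto (fun i => z i (s i)) l (𝓝 (z₀ s₀))) :
    Tendsto (fun i => z i (t i)) l (𝓝 (z₀ t₀)) := by
  have hc := hz₀.continuous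
  have h1 : Tendsto (fun i => ‖z i (s i) - z₀ (s i)‖ * Real.exp (Λ * |t i - s i|)) l
      (𝓝 (‖z₀ s₀ - z₀ s₀‖ * Real.exp (Λ * |t₀ - s₀|))) :=
    (h.sub ((hc.tendsto _).comp hs)).norm.mul
      ((Real.continuous_exp.tendsto _).comp ((ht.sub hs).abs.const_mul Λ))
  rw [sub_self, norm_zero, zero_mul] at h1
  have h2 : Tendsto (fun i => z i (t i) - z₀ (t i)) l (𝓝 0) :=
    squeeze_zero_norm (fun i => hF.norm_sub_le (hz i) hz₀ (s i) (t i)) h1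
  have h3 := h2.add ((hc.tendsto _).comp ht)
  simpa using h3

/-- Compactness without subsequences: the continuity proofs take a limit along an ultrafilter, show
that it has the defining property, and identify it by uniqueness. -/
theorem Ultrafilter.exists_tendsto_of_norm_le [ProperSpace E] (U : Ultrafilter ι) {y : ι → E}
    {R : ℝ} (h : ∀ᶠ i in (U : Filter ι), ‖y i‖ ≤ R) : ∃ x, Tendsto y U (𝓝 x) := by
  have hc := isCompact_closedBall (0 : E) R
  rw [isCompact_iff_ultrafilter_le_nhds] at hc
  obtain ⟨x, -, hx⟩ := hc (U.map y) (by
    rw [Ultrafilter.coe_map, le_principal_iff, Filter.mem_map]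
    filter_upwards [h] with i hi
    simpa using hi)
  exact ⟨x, hx⟩

namespace ExpDichotomy

variable [ProperSpace E]

/-- Continuity of the bracket of two solutions. -/
theorem tendsto_bracket (D : ExpDichotomy M Z P K α β) (hh : IsPert h L) (hL : 4 * K * L < α)
    (U : Ultrafilter ι) {a b z : ι → ℝ → E} {a₀ b₀ z₀ : ℝ → E}
    (ha : ∀ i, IsSolution (field M h) (a i)) (hb : ∀ i, IsSolution (field M h) (b i))
    (hz : ∀ i, IsSolution (field M h) (z i)) (ha₀ : IsSolution (field M h) a₀)
    (hb₀ : IsSolution (field M h) b₀) (hz₀ : IsSolution (field M h) z₀)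
    (hza : ∀ i, BddFuture fun t => z i (-t) - a i (-t)) (hzb : ∀ i, BddFuture fun t => z i t - b i t)
    (hza₀ : BddFuture fun t => z₀ (-t) - a₀ (-t)) (hzb₀ : BddFuture fun t => z₀ t - b₀ t)
    (hat : Tendsto (fun i => a i 0) U (𝓝 (a₀ 0))) (hbt : Tendsto (fun i => b i 0) U (𝓝 (b₀ 0))) :
    Tendsto (fun i => z i 0) U (𝓝 (z₀ 0)) := by
  have hF := D.isLipField_field hh
  have hbr := fun i => D.bracket_bound hh hL (ha i) (hb i) (hz i) (hza i) (hzb i) 0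
  have hJ : Tendsto (fun i => 2 * K * ‖a i 0 - b i 0‖) U (𝓝 (2 * K * ‖a₀ 0 - b₀ 0‖)) :=
    (hat.sub hbt).norm.const_mul _
  obtain ⟨y, hy⟩ : ∃ y, Tendsto (fun i => z i 0) U (𝓝 y) := by
    refine U.exists_tendsto_of_norm_le (R := 2 * K * ‖a₀ 0 - b₀ 0‖ + 1 + (‖a₀ 0‖ + 1)) ?_
    filter_upwards [hJ.eventually (gt_mem_nhds (lt_add_one _)),
      hat.norm.eventually (gt_mem_nhds (lt_add_one _))] with i h1 h2
    have h3 := (hbr i).1 0 le_rfl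
    have h4 := norm_add_le (z i 0 - a i 0) (a i 0)
    rw [sub_add_cancel] at h4
    linarith
  obtain ⟨z', hz', hz'0⟩ := hF.exists_solution 0 y
  rw [← hz'0] at hy
  have lim : ∀ {x : ι → ℝ → E} {x₀ : ℝ → E}, (∀ i, IsSolution (field M h) (x i)) →
      IsSolution (field M h) x₀ → Tendsto (fun i => x i 0) U (𝓝 (x₀ 0)) → ∀ t,
      Tendsto (fun i => x i t) U (𝓝 (x₀ t)) := fun h1 h2 h3 t =>
    hF.tendsto_solution h1 h2 tendsto_const_nhds tendsto_const_nhds h3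
  -- The bracket bounds are uniform in `i` and survive pointwise limits, so the limit curve is at
  -- bounded distance from the limits of `a` and `b`. Expansivity identifies it.
  have e : z' = z₀ := by
    refine D.eq_of_bdd hh hL hz' hz₀ (exists_bound_of_bddFuture ?_ ?_)
    · have h1 : BddFuture fun t => z' t - b₀ t := ⟨_, fun t ht =>
        le_of_tendsto_of_tendsto' ((lim hz hz' hy t).sub (lim hb hb₀ hbt t)).norm hJ
          fun i => (hbr i).2 t ht⟩
      simpa using h1.sub hzb₀
    · have h1 : BddFuture fun t => z' (-t) - a₀ (-t) := ⟨_, fun t ht =>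
        le_of_tendsto_of_tendsto' ((lim hz hz' hy (-t)).sub (lim ha ha₀ hat (-t))).norm hJ
          fun i => (hbr i).1 (-t) (by linarith)⟩
      simpa using h1.sub hza₀
  rwa [e] at hy

omit [ProperSpace E] in
theorem eventually_ne_zero (D : ExpDichotomy M Z P K α β) (hh : IsPert h L) {l : Filter ι}
    {a : ι → ℝ → E} {a₀ : ℝ → E} (ha₀ : IsSolution (field M h) a₀)
    (hne : a₀ ≠ 0) (hat : Tendsto (fun i => a i 0) l (𝓝 (a₀ 0))) : ∀ᶠ i in l, a i ≠ 0 := by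
  have h0 : a₀ 0 ≠ 0 := fun h0 =>
    hne ((D.isLipField_field hh).eq_of_eq ha₀ (isSolution_zero M hh) (s := 0) h0)
  filter_upwards [hat.eventually_ne h0] with i hi h1
  exact hi (by rw [h1]; rfl)

/-- Continuity of the crossing time. -/
theorem tendsto_crossing (D : ExpDichotomy M Z P K α β) (hh : IsPert h L) (hL : 4 * K * L < α)
    {l : Filter ι} {a : ι → ℝ → E} {a₀ : ℝ → E} (ha : ∀ i, StableSol M h (a i))
    (ha₀ : StableSol M h a₀) {T₀ : ℝ} (hT₀ : stableNorm Z P α T₀ (a₀ T₀) = 1) {T : ι → ℝ}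
    (hat : Tendsto (fun i => a i 0) l (𝓝 (a₀ 0)))
    (hT : ∀ i, a i ≠ 0 → stableNorm Z P α (T i) (a i (T i)) = 1) : Tendsto T l (𝓝 T₀) := by
  have hF := D.isLipField_field hh
  have hne := D.ne_zero_of_stableNorm_eq_one hT₀
  have lim : ∀ t, Tendsto (fun i => stableNorm Z P α t (a i t)) l
      (𝓝 (stableNorm Z P α t (a₀ t))) := by
    intro t
    have h1 := hF.tendsto_solution (fun i => (ha i).1) ha₀.1 tendsto_const_nhds
      (tendsto_const_nhds (x := t)) hat
    have h2 : Tendsto (fun i => (t, a i t)) l (𝓝 (t, a₀ t)) := tendsto_const_nhds.prodMk_nhds h1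
    have h3 := D.continuous_stableNorm.tendsto (t, a₀ t)
    have h4 := h3.comp h2
    simpa only [Function.comp_def] using h4
  have hanti := D.stableNorm_strictAnti hh hL ha₀ hne
  rw [Metric.tendsto_nhds]
  intro ε hε
  -- At T₀ ± ε the seminorm of the limit is strictly on either side of 1. This persists for nearby
  -- curves, and strict monotonicity traps their crossing times in between.
  have h1 : 1 < stableNorm Z P α (T₀ - ε) (a₀ (T₀ - ε)) := by
    rw [← hT₀]; exact hanti (by linarith)
  have h2 : stableNorm Z P α (T₀ + ε) (a₀ (T₀ + ε)) < 1 := by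
    rw [← hT₀]; exact hanti (by linarith)
  filter_upwards [(lim _).eventually (lt_mem_nhds h1), (lim _).eventually (gt_mem_nhds h2),
    D.eventually_ne_zero hh ha₀.1 hne hat] with i h3 h4 hnei
  have hai := D.stableNorm_strictAnti hh hL (ha i) hnei
  have hTi := hT i hnei
  have h5 : T₀ - ε < T i := by
    refine hai.lt_iff_gt.mp ?_
    change stableNorm Z P α (T i) (a i (T i)) < _
    rwa [hTi]
  have h6 : T i < T₀ + ε := by
    refine hai.lt_iff_gt.mp ?_
    change _ < stableNorm Z P α (T i) (a i (T i))
    rwa [hTi]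
  rw [Real.dist_eq, abs_lt]
  constructor <;> linarith

/-- Continuity of the matching of stable solutions. -/
theorem tendsto_matched (D : ExpDichotomy M Z P K α β) (hh₁ : IsPert h₁ L₁) (hL₁ : 4 * K * L₁ < α)
    (hh₂ : IsPert h₂ L₂) (hL₂ : 4 * K * L₂ < α) (U : Ultrafilter ι) {a b : ι → ℝ → E}
    {a₀ b₀ : ℝ → E} (ha : ∀ i, StableSol M h₁ (a i)) (hb : ∀ i, StableSol M h₂ (b i))
    (ha₀ : StableSol M h₁ a₀) (hb₀ : StableSol M h₂ b₀) (hm : ∀ i, Matched Z P α (a i) (b i))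
    (hm₀ : Matched Z P α a₀ b₀) (hat : Tendsto (fun i => a i 0) U (𝓝 (a₀ 0))) :
    Tendsto (fun i => b i 0) U (𝓝 (b₀ 0)) := by
  have hF₁ := D.isLipField_field hh₁
  have hF₂ := D.isLipField_field hh₂
  -- For a pair of vanishing curves the time 0 is a dummy value; such pairs are excluded eventually
  -- when the limit is nonzero.
  have hm' : ∀ i, ∃ T, (a i = 0 ∧ b i = 0) ∨
      (stableNorm Z P α T (a i T) = 1 ∧ P T (a i T) = P T (b i T)) := fun i =>
    (hm i).elim (fun h0 => ⟨0, Or.inl h0⟩) fun ⟨T, hT⟩ => ⟨T, Or.inr hT⟩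
  choose T hT using hm'
  rcases hm₀ with ⟨h1, h2⟩ | ⟨T₀, hT₀, hP₀⟩
  -- At the zero solution there is no limiting crossing time; continuity there is exactly the
  -- simultaneous smallness of matched solutions.
  · rw [h2, Pi.zero_apply, Metric.tendsto_nhds]
    intro ε hε
    obtain ⟨δ, hδ, hsm⟩ := D.matched_small hh₁ hL₁ hh₂ hL₂ hε
    rw [h1, Pi.zero_apply, Metric.tendsto_nhds] at hat
    filter_upwards [hat δ hδ] with i hi
    rw [dist_zero_right] at hi ⊢
    exact hsm (a i) (b i) 0 (ha i) (hb i) (hm i) hi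
  · have hne := D.ne_zero_of_stableNorm_eq_one hT₀
    have hTt := D.tendsto_crossing hh₁ hL₁ (fun i => (ha i)) ha₀ hT₀ (T := T) hat (fun i hi =>
      ((hT i).resolve_left fun h0 => hi h0.1).1)
    obtain ⟨r, hr⟩ := D.matched_bound hh₁ hL₁ hh₂ hL₂ (‖a₀ 0‖ + 1)
    have hbr : ∀ᶠ i in (U : Filter ι), ‖b i 0‖ ≤ r := by
      filter_upwards [hat.norm.eventually (gt_mem_nhds (lt_add_one _))] with i hi
      exact hr (a i) (b i) 0 (ha i) (hb i) (hm i) hi.le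
    obtain ⟨y, hy⟩ := U.exists_tendsto_of_norm_le hbr
    obtain ⟨b', hb', hb'0⟩ := hF₂.exists_solution 0 y
    rw [← hb'0] at hy
    -- The forward bounds 2Kr are uniform along the ultrafilter, so the limit is again a stable
    -- solution.
    have hst : StableSol M h₂ b' := by
      refine ⟨hb', 2 * K * r, fun t ht => ?_⟩
      have h1 := hF₂.tendsto_solution (fun i => (hb i).1) hb' tendsto_const_nhds
        (tendsto_const_nhds (x := t)) hy
      refine le_of_tendsto h1.norm ?_
      filter_upwards [hbr] with i hi
      exact (D.stableSol_bound hh₂ hL₂ (hb i) ht).trans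
        (mul_le_mul_of_nonneg_left hi (by have := D.K_pos; positivity))
    have hat' := hF₁.tendsto_solution (fun i => (ha i).1) ha₀.1 tendsto_const_nhds hTt hat
    have hbt' := hF₂.tendsto_solution (fun i => (hb i).1) hb' tendsto_const_nhds hTt hy
    have hPa : Tendsto (fun i => P (T i) (a i (T i))) U (𝓝 (P T₀ (a₀ T₀))) :=
      (D.continuous_proj.tendsto (T₀, a₀ T₀)).comp (hTt.prodMk_nhds hat')
    have hPb : Tendsto (fun i => P (T i) (b i (T i))) U (𝓝 (P T₀ (b' T₀))) :=
      (D.continuous_proj.tendsto (T₀, b' T₀)).comp (hTt.prodMk_nhds hbt')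
    have hPab : P T₀ (a₀ T₀) = P T₀ (b' T₀) := by
      refine tendsto_nhds_unique (hPa.congr' ?_) hPb
      filter_upwards [D.eventually_ne_zero hh₁ ha₀.1 hne hat] with i hi
      exact ((hT i).resolve_left fun h0 => hi h0.1).2
    have e : b' = b₀ := D.stableSol_unique hh₂ hL₂ hst hb₀ (hPab.symm.trans hP₀)
    rwa [e] at hy

end ExpDichotomy

end Limits

end Matching

/-! ### Correspondence of solutions and the conjugating homeomorphisms. -/

section Conjugacy

set_option linter.unusedSectionVars false

variable {E : Type*} [NormedAddCommGroup E] [NormedSpace ℝ E]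

/-- `a` is the solution on the stable manifold asymptotic to `z` in the past. -/
def IsStablePart (M : ℝ → E →L[ℝ] E) (h : ℝ → E → E) (z a : ℝ → E) : Prop :=
  StableSol M h a ∧ BddFuture fun t => z (-t) - a (-t)

/-- Solutions of two perturbed systems whose stable parts are matched. -/
def StableRel (M : ℝ → E →L[ℝ] E) (Z : ℝ → ℝ → E →L[ℝ] E) (P : ℝ → E →L[ℝ] E) (α : ℝ)
    (h₁ h₂ : ℝ → E → E) (z₁ z₂ : ℝ → E) : Prop :=
  ∃ a₁ a₂, IsStablePart M h₁ z₁ a₁ ∧ IsStablePart M h₂ z₂ a₂ ∧ Matched Z P α a₁ a₂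

/-- Solutions of two perturbed systems whose stable and unstable parts are matched. -/
def ConjRel (M : ℝ → E →L[ℝ] E) (Z : ℝ → ℝ → E →L[ℝ] E) (P : ℝ → E →L[ℝ] E) (α : ℝ)
    (h₁ h₂ : ℝ → E → E) (z₁ z₂ : ℝ → E) : Prop :=
  IsSolution (field M h₁) z₁ ∧ IsSolution (field M h₂) z₂ ∧ StableRel M Z P α h₁ h₂ z₁ z₂ ∧
    StableRel (revMat M) (revTrans Z) (revProj P) α (revPert h₁) (revPert h₂)
      (fun t => z₁ (-t)) (fun t => z₂ (-t))

variable {M : ℝ → E →L[ℝ] E} {Z : ℝ → ℝ → E →L[ℝ] E} {P : ℝ → E →L[ℝ] E} {K α β L : ℝ}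
  {h h₁ h₂ : ℝ → E → E} {L₁ L₂ : ℝ}

theorem StableRel.symm {z₁ z₂ : ℝ → E} (hr : StableRel M Z P α h₁ h₂ z₁ z₂) :
    StableRel M Z P α h₂ h₁ z₂ z₁ := by
  obtain ⟨a₁, a₂, h1, h2, h3⟩ := hr
  exact ⟨a₂, a₁, h2, h1, h3.symm⟩

theorem ConjRel.symm {z₁ z₂ : ℝ → E} (hr : ConjRel M Z P α h₁ h₂ z₁ z₂) :
    ConjRel M Z P α h₂ h₁ z₂ z₁ :=
  ⟨hr.2.1, hr.1, hr.2.2.1.symm, hr.2.2.2.symm⟩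

theorem BddFuture.neg {d : ℝ → E} (hd : BddFuture d) : BddFuture fun t => -d t := by
  obtain ⟨C, hC⟩ := hd
  exact ⟨C, fun t ht => by simpa using hC t ht⟩

theorem BddFuture.sub_comm {d e : ℝ → E} (hd : BddFuture fun t => d t - e t) :
    BddFuture fun t => e t - d t := by
  simpa using hd.neg

/-- A stable part in reversed time is a solution on the unstable manifold. -/
theorem IsStablePart.of_rev {z b : ℝ → E}
    (hb : IsStablePart (revMat M) (revPert h) (fun t => z (-t)) b) :
    IsSolution (field M h) (fun t => b (-t)) ∧ BddFuture fun t => z t - b (-t) :=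
  ⟨hb.1.1.of_rev, by simpa using hb.2⟩

namespace ExpDichotomy

section Complete

variable [CompleteSpace E]

/-- The stable part is the bracket that follows `z` in the past and the zero solution in the future.
-/
theorem exists_stablePart (D : ExpDichotomy M Z P K α β) (hh : IsPert h L) (hL : 4 * K * L < α)
    {z : ℝ → E} (hz : IsSolution (field M h) z) : ∃ a, IsStablePart M h z a := by
  obtain ⟨a, ha, h1, h2⟩ := D.exists_bracket hh hL hz (isSolution_zero M hh) 0
  refine ⟨a, ⟨ha, _, fun t ht => by simpa using h2 t ht⟩, 2 * K * ‖z 0 - 0‖, fun t ht => ?_⟩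
  rw [norm_sub_rev]
  exact h1 (-t) (by linarith)

theorem stablePart_unique (D : ExpDichotomy M Z P K α β) (hh : IsPert h L) (hL : 4 * K * L < α)
    {z a a' : ℝ → E} (ha : IsStablePart M h z a) (ha' : IsStablePart M h z a') : a = a' := by
  refine D.eq_of_bdd hh hL ha.1.1 ha'.1.1
    (exists_bound_of_bddFuture (ha.1.2.sub ha'.1.2) ?_)
  simpa using ha'.2.sub ha.2

theorem stablePart_norm_le (D : ExpDichotomy M Z P K α β) (hh : IsPert h L) (hL : 4 * K * L < α)
    {z a : ℝ → E} (hz : IsSolution (field M h) z) (ha : IsStablePart M h z a) (τ : ℝ) :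
    ‖a τ‖ ≤ 2 * K * ‖z τ‖ := by
  have := (D.bracket_bound hh hL hz (isSolution_zero M hh) ha.1.1 ha.2.sub_comm
    (by simpa using ha.1.2) τ).2 τ le_rfl
  simpa using this

/-- Split into stable and unstable parts, match each with a part of the second system, and
reassemble by the bracket. -/
theorem exists_conjRel (D : ExpDichotomy M Z P K α β) (hh₁ : IsPert h₁ L₁) (hL₁ : 4 * K * L₁ < α)
    (hh₂ : IsPert h₂ L₂) (hL₂ : 4 * K * L₂ < α) {z₁ : ℝ → E} (hz₁ : IsSolution (field M h₁) z₁) :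
    ∃ z₂, ConjRel M Z P α h₁ h₂ z₁ z₂ := by
  obtain ⟨a₁, ha₁⟩ := D.exists_stablePart hh₁ hL₁ hz₁
  obtain ⟨b₁, hb₁⟩ := D.rev.exists_stablePart hh₁.rev hL₁ hz₁.rev
  obtain ⟨a₂, ha₂, hma⟩ := D.exists_matched hh₁ hL₁ hh₂ hL₂ ha₁.1
  obtain ⟨b₂, hb₂, hmb⟩ := D.rev.exists_matched hh₁.rev hL₁ hh₂.rev hL₂ hb₁.1
  obtain ⟨z₂, hz₂, h1, h2⟩ := D.exists_bracket hh₂ hL₂ ha₂.1 hb₂.1.of_rev 0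
  refine ⟨z₂, hz₁, hz₂, ⟨a₁, a₂, ha₁, ⟨ha₂, _, fun t ht => h1 (-t) (by linarith)⟩, hma⟩,
    b₁, b₂, hb₁, ⟨hb₂, 2 * K * ‖a₂ 0 - b₂ (-0)‖, fun t ht => ?_⟩, hmb⟩
  simpa using h2 t ht

theorem stableRel_unique (D : ExpDichotomy M Z P K α β) (hh₁ : IsPert h₁ L₁)
    (hL₁ : 4 * K * L₁ < α) (hh₂ : IsPert h₂ L₂) (hL₂ : 4 * K * L₂ < α) {z₁ z₂ z₂' : ℝ → E}
    (hr : StableRel M Z P α h₁ h₂ z₁ z₂) (hr' : StableRel M Z P α h₁ h₂ z₁ z₂') :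
    BddFuture fun t => z₂ (-t) - z₂' (-t) := by
  obtain ⟨a₁, a₂, h1, h2, h3⟩ := hr
  obtain ⟨a₁', a₂', h1', h2', h3'⟩ := hr'
  have e₁ := D.stablePart_unique hh₁ hL₁ h1 h1'
  subst e₁
  have e₂ := D.matched_unique hh₁ hL₁ hh₂ hL₂ h1.1 h2.1 h2'.1 h3 h3'
  subst e₂
  simpa using h2.2.sub h2'.2

/-- Two partners share their stable part, hence stay close in the past, and share their unstable
part, hence stay close in the future; expansivity concludes. -/
theorem conjRel_unique (D : ExpDichotomy M Z P K α β) (hh₁ : IsPert h₁ L₁) (hL₁ : 4 * K * L₁ < α)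
    (hh₂ : IsPert h₂ L₂) (hL₂ : 4 * K * L₂ < α) {z₁ z₂ z₂' : ℝ → E}
    (hr : ConjRel M Z P α h₁ h₂ z₁ z₂) (hr' : ConjRel M Z P α h₁ h₂ z₁ z₂') : z₂ = z₂' := by
  refine D.eq_of_bdd hh₂ hL₂ hr.2.1 hr'.2.1 (exists_bound_of_bddFuture ?_ ?_)
  · simpa using D.rev.stableRel_unique hh₁.rev hL₁ hh₂.rev hL₂ hr.2.2.2 hr'.2.2.2
  · exact D.stableRel_unique hh₁ hL₁ hh₂ hL₂ hr.2.2.1 hr'.2.2.1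

/-- The bound is independent of the time τ. Applied to the inverse correspondence, it yields the
uniform divergence of H(t, z) as z tends to infinity. -/
theorem conjRel_bound (D : ExpDichotomy M Z P K α β) (hh₁ : IsPert h₁ L₁) (hL₁ : 4 * K * L₁ < α)
    (hh₂ : IsPert h₂ L₂) (hL₂ : 4 * K * L₂ < α) (R : ℝ) :
    ∃ r, ∀ (z₁ z₂ : ℝ → E) (τ : ℝ), ConjRel M Z P α h₁ h₂ z₁ z₂ → ‖z₁ τ‖ ≤ R → ‖z₂ τ‖ ≤ r := by
  have hK := D.K_pos
  obtain ⟨r, hr⟩ := D.matched_bound hh₁ hL₁ hh₂ hL₂ (2 * K * R)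
  obtain ⟨r', hr'⟩ := D.rev.matched_bound hh₁.rev hL₁ hh₂.rev hL₂ (2 * K * R)
  refine ⟨2 * K * (r + r') + r, ?_⟩
  rintro z₁ z₂ τ ⟨hz₁, hz₂, ⟨a₁, a₂, ha₁, ha₂, hma⟩, b₁, b₂, hb₁, hb₂, hmb⟩ hR
  have h2KR : 2 * K * ‖z₁ τ‖ ≤ 2 * K * R := mul_le_mul_of_nonneg_left hR (by positivity)
  have h1 := hr a₁ a₂ τ ha₁.1 ha₂.1 hma ((D.stablePart_norm_le hh₁ hL₁ hz₁ ha₁ τ).trans h2KR)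
  have h2 := hr' b₁ b₂ (-τ) hb₁.1 hb₂.1 hmb
    ((D.rev.stablePart_norm_le hh₁.rev hL₁ hz₁.rev hb₁ (-τ)).trans (by simpa using h2KR))
  have h3 := (D.bracket_bound hh₂ hL₂ ha₂.1.1 hb₂.of_rev.1 hz₂ ha₂.2 hb₂.of_rev.2 τ).1 τ le_rfl
  have h4 := norm_add_le (z₂ τ - a₂ τ) (a₂ τ)
  rw [sub_add_cancel] at h4
  have h5 := mul_le_mul_of_nonneg_left ((norm_sub_le (a₂ τ) (b₂ (-τ))).trans (add_le_add h1 h2))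
    (show 0 ≤ 2 * K by positivity)
  linarith

end Complete

variable [ProperSpace E] {ι : Type*}

theorem tendsto_stablePart (D : ExpDichotomy M Z P K α β) (hh : IsPert h L) (hL : 4 * K * L < α)
    (U : Ultrafilter ι) {z a : ι → ℝ → E} {z₀ a₀ : ℝ → E}
    (hz : ∀ i, IsSolution (field M h) (z i)) (hz₀ : IsSolution (field M h) z₀)
    (ha : ∀ i, IsStablePart M h (z i) (a i)) (ha₀ : IsStablePart M h z₀ a₀)
    (hzt : Tendsto (fun i => z i 0) U (𝓝 (z₀ 0))) : Tendsto (fun i => a i 0) U (𝓝 (a₀ 0)) :=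
  D.tendsto_bracket hh hL U (b := fun _ _ => 0) (b₀ := fun _ => 0) hz
    (fun _ => isSolution_zero M hh) (fun i => (ha i).1.1) hz₀ (isSolution_zero M hh) ha₀.1.1
    (fun i => (ha i).2.sub_comm) (fun i => by simpa using (ha i).1.2) ha₀.2.sub_comm
    (by simpa using ha₀.1.2) hzt tendsto_const_nhds

theorem tendsto_conjRel (D : ExpDichotomy M Z P K α β) (hh₁ : IsPert h₁ L₁)
    (hL₁ : 4 * K * L₁ < α) (hh₂ : IsPert h₂ L₂) (hL₂ : 4 * K * L₂ < α) (U : Ultrafilter ι)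
    {z₁ z₂ : ι → ℝ → E} {w₁ w₂ : ℝ → E} (hr : ∀ i, ConjRel M Z P α h₁ h₂ (z₁ i) (z₂ i))
    (hr₀ : ConjRel M Z P α h₁ h₂ w₁ w₂) (hz : Tendsto (fun i => z₁ i 0) U (𝓝 (w₁ 0))) :
    Tendsto (fun i => z₂ i 0) U (𝓝 (w₂ 0)) := by
  obtain ⟨hw₁, hw₂, ⟨a₁', a₂', ha₁', ha₂', hma'⟩, b₁', b₂', hb₁', hb₂', hmb'⟩ := hr₀
  choose hz₁ hz₂ hs hu using hr
  choose a₁ a₂ ha₁ ha₂ hma using hs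
  choose b₁ b₂ hb₁ hb₂ hmb using hu
  have t1 := D.tendsto_stablePart hh₁ hL₁ U hz₁ hw₁ ha₁ ha₁' hz
  have t2 := D.rev.tendsto_stablePart hh₁.rev hL₁ U (fun i => (hz₁ i).rev) hw₁.rev hb₁ hb₁'
    (by simpa using hz)
  have t3 := D.tendsto_matched hh₁ hL₁ hh₂ hL₂ U (fun i => (ha₁ i).1) (fun i => (ha₂ i).1)
    ha₁'.1 ha₂'.1 hma hma' t1
  have t4 := D.rev.tendsto_matched hh₁.rev hL₁ hh₂.rev hL₂ U (fun i => (hb₁ i).1)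
    (fun i => (hb₂ i).1) hb₁'.1 hb₂'.1 hmb hmb' t2
  exact D.tendsto_bracket hh₂ hL₂ U (fun i => (ha₂ i).1.1) (fun i => (hb₂ i).of_rev.1) hz₂
    ha₂'.1.1 hb₂'.of_rev.1 hw₂ (fun i => (ha₂ i).2) (fun i => (hb₂ i).of_rev.2) ha₂'.2
    hb₂'.of_rev.2 t3 (by simpa using t4)

/-- The conjugating map of two perturbed systems. -/
theorem exists_conj (D : ExpDichotomy M Z P K α β) (hh₁ : IsPert h₁ L₁) (hL₁ : 4 * K * L₁ < α)
    (hh₂ : IsPert h₂ L₂) (hL₂ : 4 * K * L₂ < α) :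
    ∃ H : ℝ → E → E, (∀ z₁ z₂, ConjRel M Z P α h₁ h₂ z₁ z₂ → ∀ t, H t (z₁ t) = z₂ t) ∧
      Continuous (fun p : ℝ × E => H p.1 p.2) ∧ ∀ R, ∃ r, ∀ t x, ‖x‖ ≤ R → ‖H t x‖ ≤ r := by
  have hF₁ := D.isLipField_field hh₁
  have hF₂ := D.isLipField_field hh₂
  -- `φ q` is the solution through the space-time point `q` and `χ q` its partner. All points of one
  -- curve give the same partner, by uniqueness on both sides.
  choose φ hφ hφτ using fun q : ℝ × E => hF₁.exists_solution q.1 q.2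
  choose χ hχ using fun q : ℝ × E => D.exists_conjRel hh₁ hL₁ hh₂ hL₂ (hφ q)
  refine ⟨fun t x => χ (t, x) t, fun z₁ z₂ hr t => ?_, ?_, fun R => ?_⟩
  · have e : φ (t, z₁ t) = z₁ := hF₁.eq_of_eq (hφ _) hr.1 (s := t) (hφτ _)
    have h1 := hχ (t, z₁ t)
    rw [e] at h1
    exact congrFun (D.conjRel_unique hh₁ hL₁ hh₂ hL₂ h1 hr) t
  · rw [continuous_iff_continuousAt]
    intro q₀
    -- Points are transported along solutions to time 0, where continuity of the correspondence is
    -- known, and back to time q.1.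
    rw [continuousAt_iff_ultrafilter]
    intro U hU
    have hfst : Tendsto (fun q : ℝ × E => q.1) U (𝓝 q₀.1) := (continuous_fst.tendsto q₀).mono_left hU
    have hsnd : Tendsto (fun q : ℝ × E => q.2) U (𝓝 q₀.2) := (continuous_snd.tendsto q₀).mono_left hU
    have h1 : Tendsto (fun q => φ q 0) U (𝓝 (φ q₀ 0)) := by
      refine hF₁.tendsto_solution hφ (hφ q₀) hfst tendsto_const_nhds ?_
      simpa only [hφτ] using hsnd
    have h2 := D.tendsto_conjRel hh₁ hL₁ hh₂ hL₂ U hχ (hχ q₀) h1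
    exact hF₂.tendsto_solution (fun q => (hχ q).2.1) (hχ q₀).2.1 tendsto_const_nhds hfst h2
  · obtain ⟨r, hr⟩ := D.conjRel_bound hh₁ hL₁ hh₂ hL₂ R
    exact ⟨r, fun t x hx => hr _ _ t (hχ (t, x)) (by rwa [hφτ])⟩

theorem isTopEquivalence_of_conj (D : ExpDichotomy M Z P K α β) (hh₁ : IsPert h₁ L₁)
    (hL₁ : 4 * K * L₁ < α) (hh₂ : IsPert h₂ L₂) (hL₂ : 4 * K * L₂ < α) {H G : ℝ → E → E}
    (hH : ∀ z₁ z₂, ConjRel M Z P α h₁ h₂ z₁ z₂ → ∀ t, H t (z₁ t) = z₂ t)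
    (hHc : Continuous fun p : ℝ × E => H p.1 p.2) (hGc : Continuous fun p : ℝ × E => G p.1 p.2)
    (hGH : ∀ t, Function.LeftInverse (G t) (H t)) (hHG : ∀ t, Function.RightInverse (G t) (H t))
    (hGb : ∀ R, ∃ r, ∀ t x, ‖x‖ ≤ R → ‖G t x‖ ≤ r) :
    IsTopEquivalence (field M h₁) (field M h₂) H where
  continuous := hHc
  homeomorph t :=
    Homeomorph.isHomeomorph
      { toFun := H t
        invFun := G t
        left_inv := hGH t
        right_inv := hHG t
        continuous_toFun := hHc.comp (by fun_prop : Continuous fun x : E => (t, x))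
        continuous_invFun := hGc.comp (by fun_prop : Continuous fun x : E => (t, x)) }
  -- If H(t, z) stays in a ball, then so does z = G(t, H(t, z)), uniformly in t.
  proper R := by
    obtain ⟨r, hr⟩ := hGb R
    refine ⟨r + 1, fun t z hz => ?_⟩
    by_contra hlt
    have := hr t (H t z) (not_le.mp hlt).le
    rw [hGH t z] at this
    linarith
  maps_solutions z hz := by
    obtain ⟨z₂, hz₂⟩ := D.exists_conjRel hh₁ hL₁ hh₂ hL₂ hz
    rw [show (fun t => H t (z t)) = z₂ from funext (hH z z₂ hz₂)]
    exact hz₂.2.1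

/-- Since the correspondence is symmetric, the map built with the two systems interchanged is the
inverse. -/
theorem topologicallyConjugated (D : ExpDichotomy M Z P K α β) (hh₁ : IsPert h₁ L₁)
    (hL₁ : 4 * K * L₁ < α) (hh₂ : IsPert h₂ L₂) (hL₂ : 4 * K * L₂ < α) :
    TopologicallyConjugated (field M h₁) (field M h₂) := by
  obtain ⟨H, hH, hHc, hHb⟩ := D.exists_conj hh₁ hL₁ hh₂ hL₂
  obtain ⟨G, hG, hGc, hGb⟩ := D.exists_conj hh₂ hL₂ hh₁ hL₁
  have hGH : ∀ t, Function.LeftInverse (G t) (H t) := by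
    intro t x
    obtain ⟨z₁, hz₁, rfl⟩ := (D.isLipField_field hh₁).exists_solution t x
    obtain ⟨z₂, hr⟩ := D.exists_conjRel hh₁ hL₁ hh₂ hL₂ hz₁
    rw [hH _ _ hr, hG _ _ hr.symm]
  have hHG : ∀ t, Function.RightInverse (G t) (H t) := by
    intro t x
    obtain ⟨z₂, hz₂, rfl⟩ := (D.isLipField_field hh₂).exists_solution t x
    obtain ⟨z₁, hr⟩ := D.exists_conjRel hh₂ hL₂ hh₁ hL₁ hz₂
    rw [hG _ _ hr, hH _ _ hr.symm]
  exact ⟨H, G, D.isTopEquivalence_of_conj hh₁ hL₁ hh₂ hL₂ hH hHc hGc hGH hHG hGb,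
    D.isTopEquivalence_of_conj hh₂ hL₂ hh₁ hL₁ hG hGc hHc hHG hGH hHb, fun t => ⟨hGH t, hHG t⟩⟩

end ExpDichotomy

end Conjugacy

/-! ### Reduction to a nonlinearity vanishing at the origin. -/

section Translation

variable {E : Type*} [NormedAddCommGroup E] [NormedSpace ℝ E]

/-- Translation by a bounded solution is harmless for topological conjugacy. -/
theorem TopologicallyConjugated.of_translate {F F' G : ℝ → E → E} {z₀ : ℝ → E}
    (hz₀ : IsSolution F z₀) {C : ℝ} (hC : ∀ t, ‖z₀ t‖ ≤ C)
    (hF : ∀ t x, F' t x = F t (x + z₀ t) - F t (z₀ t)) (h : TopologicallyConjugated F' G) :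
    TopologicallyConjugated F G := by
  obtain ⟨H, L, hH, hL, hHL⟩ := h
  have hc := hz₀.continuous
  refine ⟨fun t x => H t (x - z₀ t), fun t x => L t x + z₀ t, ⟨?_, ?_, ?_, ?_⟩, ⟨?_, ?_, ?_, ?_⟩, ?_⟩
  · exact hH.continuous.comp (by fun_prop : Continuous fun p : ℝ × E => (p.1, p.2 - z₀ p.1))
  · intro t
    exact (hH.homeomorph t).comp (Homeomorph.subRight (z₀ t)).isHomeomorph
  · intro R
    obtain ⟨r, hr⟩ := hH.proper R
    refine ⟨r + C, fun t z hz => hr t _ ?_⟩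
    have := norm_sub_norm_le z (z₀ t)
    have := hC t
    linarith
  · intro z hz
    refine hH.maps_solutions (fun t => z t - z₀ t) ?_
    exact (hz.isPrimitive.sub hz₀.isPrimitive).congr fun t => by simp [hF]
  · exact hL.continuous.add (hc.comp continuous_fst)
  · intro t
    exact (Homeomorph.addRight (z₀ t)).isHomeomorph.comp (hL.homeomorph t)
  · intro R
    obtain ⟨r, hr⟩ := hL.proper (R + C)
    refine ⟨r, fun t z hz => ?_⟩
    have h1 := hr t z hz
    have h2 := hC t
    have h3 := norm_sub_le (L t z + z₀ t) (z₀ t)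
    rw [add_sub_cancel_right] at h3
    linarith
  · intro z hz
    exact ((hL.maps_solutions z hz).isPrimitive.add hz₀.isPrimitive).congr fun t => by simp [hF]
  · intro t
    refine ⟨fun x => ?_, fun x => ?_⟩
    · simp [(hHL t).1 (x - z₀ t)]
    · simp [(hHL t).2 x]

end Translation

/-! ### From the stated dichotomy to its invariant form, and the conjugacy with the linear system.
-/

section ExpDichotomyOn

variable {E : Type*} [NormedAddCommGroup E] [NormedSpace ℝ E]

theorem HasExpDichotomy.exists_expDichotomy [CompleteSpace E] {M : ℝ → E →L[ℝ] E} {K α β : ℝ}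
    (hd : HasExpDichotomy M K α) (hm : AEStronglyMeasurable M volume) (hM : ∀ t, ‖M t‖ ≤ β)
    (hK : 1 ≤ K) (hα : 0 < α) : ∃ Z P, ExpDichotomy M Z P K α β := by
  obtain ⟨Z, P, hZ, hP, hs, hu⟩ := hd
  have hβ : 0 ≤ β := (norm_nonneg _).trans (hM 0)
  have hself : ∀ s x, Z s s x = x := fun s x => by rw [(hZ s).2]; rfl
  have hsol : ∀ s x, IsPrimitive (fun t => M t (Z t s x)) (fun t => Z t s x) := fun s x =>
    (hZ s).1.isPrimitive.clm_apply_const (ContinuousLinearMap.apply ℝ E x)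
  have hcomp : ∀ t r s x, Z t r (Z r s x) = Z t s x := by
    intro t r s x
    have := ((hsol r (Z r s x)).sub (hsol s x)).gronwall_abs hβ (fun u => by
      rw [← map_sub]
      exact (M u).le_of_opNorm_le (hM u) _) r t
    rw [hself, sub_self, norm_zero, zero_mul] at this
    exact sub_eq_zero.mp (norm_le_zero_iff.mp this)
  have hPP : ∀ x, P (P x) = P x := fun x => by
    conv_rhs => rw [← hP]
    rfl
  -- The projection at time 0 is transported along the flow, giving a family that commutes with the
  -- transition matrix.
  set Q : ℝ → E →L[ℝ] E := fun t => ((Z t 0).comp P).comp (Z 0 t) with hQ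
  have hQa : ∀ t x, Q t x = Z t 0 (P (Z 0 t x)) := fun _ _ => rfl
  have hZQ : ∀ t s x, Z t s (Q s x) = Z t 0 (P (Z 0 s x)) := fun t s x => by rw [hQa, hcomp]
  have hunst : ∀ t s x, t < s → ‖Z t s (x - Q s x)‖ ≤ K * Real.exp (-α * (s - t)) * ‖x‖ := by
    intro t s x hts
    have h1 := hu t s hts
    rw [abs_of_nonpos (by linarith), neg_sub] at h1
    have h2 := ContinuousLinearMap.le_of_opNorm_le _ h1 x
    convert h2 using 1
    rw [map_sub, hZQ]
    simp [hcomp, norm_sub_rev]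
  refine ⟨Z, Q, hm, hM, fun s => (hZ s).1, hself, hcomp, fun t x => ?_, fun t s x => ?_,
    fun t s x hst => ?_, fun t s x hts => ?_, hK, hα⟩
  · rw [hQa, hQa, hcomp, hself, hPP]
  · rw [hZQ, hQa, hcomp]
  · have h1 := hs t s hst
    rw [abs_of_nonneg (by linarith)] at h1
    have h2 := ContinuousLinearMap.le_of_opNorm_le _ h1 x
    rw [hZQ]
    exact h2
  -- The given unstable estimate excludes t = s; the diagonal case follows by letting the first time
  -- tend to it from the left.
  · rcases hts.lt_or_eq with hlt | rfl
    · exact hunst t s x hlt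
    · have hc : Continuous fun u => Z u t (x - Q t x) := (hsol t _).continuous
      have l1 : Tendsto (fun u => ‖Z u t (x - Q t x)‖) (𝓝[<] t) (𝓝 ‖Z t t (x - Q t x)‖) :=
        (hc.norm.tendsto t).mono_left nhdsWithin_le_nhds
      have hc2 : Continuous fun u => K * Real.exp (-α * (t - u)) * ‖x‖ := by fun_prop
      have l2 := (hc2.tendsto t).mono_left (nhdsWithin_le_nhds (s := Iio t))
      refine le_of_tendsto_of_tendsto l1 l2 ?_
      filter_upwards [self_mem_nhdsWithin] with u hu
      exact hunst u t x hu

/-- A Lipschitz perturbation, bounded along the zero state, of a system with an exponential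
dichotomy is topologically conjugated to the linear system. -/
theorem ExpDichotomy.topologicallyConjugated_linear [ProperSpace E] {M : ℝ → E →L[ℝ] E}
    {Z : ℝ → ℝ → E →L[ℝ] E} {P : ℝ → E →L[ℝ] E} {K α β L : ℝ} (D : ExpDichotomy M Z P K α β)
    {h : ℝ → E → E} (hh : IsLipField h L) (hL : 4 * K * L < α) :
    TopologicallyConjugated (fun t x => M t x + h t x) (fun t x => M t x) := by
  have hKL : 0 ≤ K * L := mul_nonneg D.K_pos.le hh.nonneg
  -- This bounded solution takes the place of the origin; in coordinates centred on it the
  -- nonlinearity vanishes at 0 with the same Lipschitz constant.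
  obtain ⟨z₀, hz₀, C, hC⟩ := D.exists_bdd_lip (by linarith) hh
  have hpert : IsPert (fun t x => h t (x + z₀ t) - h t (z₀ t)) L :=
    { meas := fun x => (hh.aestronglyMeasurable (continuous_const.add hz₀.continuous)).sub
        (hh.aestronglyMeasurable hz₀.continuous)
      lip := fun t x y => by simpa using hh.lip t (x + z₀ t) (y + z₀ t)
      nonneg := hh.nonneg
      bdd := ⟨0, fun t => by simp⟩
      zero := fun t => by simp }
  have hzero : IsPert (fun (_ : ℝ) (_ : E) => (0 : E)) 0 :=
    { meas := fun x => aestronglyMeasurable_const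
      lip := fun t x y => by simp
      nonneg := le_rfl
      bdd := ⟨0, fun t => by simp⟩
      zero := fun t => rfl }
  have key := D.topologicallyConjugated hpert hL hzero (by simpa using D.pos)
  have e : field M (fun (_ : ℝ) (_ : E) => (0 : E)) = fun t x => M t x := by
    funext t x; simp [field]
  rw [e] at key
  refine key.of_translate hz₀ hC fun t x => ?_
  simp only [field, map_add]
  abel

end ExpDichotomyOn

/-! ### The coupled system on the product space. -/

theorem corollary1 {X Y : Type*}
    [NormedAddCommGroup X] [NormedSpace ℝ X] [FiniteDimensional ℝ X]
    [NormedAddCommGroup Y] [NormedSpace ℝ Y] [FiniteDimensional ℝ Y]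
    (A : ℝ → X →L[ℝ] X) (B : ℝ → Y →L[ℝ] Y)
    (f : ℝ → X → X) (g : ℝ → X → Y) (φ : ℝ → Y → X) (ψ : ℝ → Y → Y)
    (β K α lam δ ω : ℝ)
    (hK : 1 ≤ K) (hα : 0 < α) (hlam : 0 < lam) (hδ : 0 < δ) (hω : 0 < ω)
    (hA_int : LocallyIntegrable A volume) (hB_int : LocallyIntegrable B volume)
    (hA_bdd : ∀ t, ‖A t‖ ≤ β) (hB_bdd : ∀ t, ‖B t‖ ≤ β)
    (hf_int : ∀ x, LocallyIntegrable (fun t => f t x) volume)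
    (hg_int : ∀ x, LocallyIntegrable (fun t => g t x) volume)
    (hφ_int : ∀ y, LocallyIntegrable (fun t => φ t y) volume)
    (hψ_int : ∀ y, LocallyIntegrable (fun t => ψ t y) volume)
    (hf_bd : ∀ t x, ‖f t x‖ ≤ lam * ‖x‖) (hg_bd : ∀ t x, ‖g t x‖ ≤ lam * ‖x‖)
    (hφ_bd : ∀ t y, ‖φ t y‖ ≤ δ) (hψ_bd : ∀ t y, ‖ψ t y‖ ≤ δ)
    (hf_lip : ∀ t x₁ x₂, ‖f t x₁ - f t x₂‖ ≤ ω * ‖x₁ - x₂‖)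
    (hg_lip : ∀ t x₁ x₂, ‖g t x₁ - g t x₂‖ ≤ ω * ‖x₁ - x₂‖)
    (hφ_lip : ∀ t y₁ y₂, ‖φ t y₁ - φ t y₂‖ ≤ ω * ‖y₁ - y₂‖)
    (hψ_lip : ∀ t y₁ y₂, ‖ψ t y₁ - ψ t y₂‖ ≤ ω * ‖y₁ - y₂‖)
    (hdich : HasExpDichotomy (fun t => (A t).prodMap (B t)) K α)
    (hKω : 8 * K * ω / α < 1) (hKlam : 8 * K * lam / α < 1) :
    TopologicallyConjugated
      (fun t (z : X × Y) => (A t z.1 + f t z.1 + φ t z.2, B t z.2 + g t z.1 + ψ t z.2))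
      (fun t (z : X × Y) => (A t z.1, B t z.2)) := by
  have : CompleteSpace X := FiniteDimensional.complete ℝ X
  have : CompleteSpace Y := FiniteDimensional.complete ℝ Y
  have : ProperSpace X := FiniteDimensional.proper_real X
  have : ProperSpace Y := FiniteDimensional.proper_real Y
  have hm : AEStronglyMeasurable (fun t => (A t).prodMap (B t)) volume :=
    (ContinuousLinearMap.prodMapL ℝ X X Y Y).continuous.comp_aestronglyMeasurable
      (hA_int.aestronglyMeasurable.prodMk hB_int.aestronglyMeasurable)
  have hb : ∀ t, ‖(A t).prodMap (B t)‖ ≤ β := by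
    intro t
    refine ContinuousLinearMap.opNorm_le_bound _ ((norm_nonneg _).trans (hA_bdd t)) fun z => ?_
    have hβ : 0 ≤ β := (norm_nonneg _).trans (hA_bdd t)
    refine norm_prod_le_iff.mpr ⟨?_, ?_⟩
    · exact (A t).le_of_opNorm_le_of_le (hA_bdd t) (norm_fst_le z)
    · exact (B t).le_of_opNorm_le_of_le (hB_bdd t) (norm_snd_le z)
  obtain ⟨Z, P, D⟩ := hdich.exists_expDichotomy hm hb hK hα
  -- Each component is a sum of two ω-Lipschitz terms, and the norm on the product is the maximum,
  -- so the constant is 2ω. At the origin f and g vanish, by their linear bounds, which leaves the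
  -- bound δ.
  have hlip : IsLipField (fun t (z : X × Y) => (f t z.1 + φ t z.2, g t z.1 + ψ t z.2))
      (2 * ω) := by
    refine ⟨fun z => ?_, fun t z w => ?_, by positivity, δ, fun t => ?_⟩
    · exact ((hf_int z.1).aestronglyMeasurable.add (hφ_int z.2).aestronglyMeasurable).prodMk
        ((hg_int z.1).aestronglyMeasurable.add (hψ_int z.2).aestronglyMeasurable)
    · have h1 : ω * ‖z.1 - w.1‖ ≤ ω * ‖z - w‖ := mul_le_mul_of_nonneg_left (norm_fst_le (z - w)) hω.le
      have h2 : ω * ‖z.2 - w.2‖ ≤ ω * ‖z - w‖ := mul_le_mul_of_nonneg_left (norm_snd_le (z - w)) hω.le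
      refine norm_prod_le_iff.mpr ⟨?_, ?_⟩
      · change ‖f t z.1 + φ t z.2 - (f t w.1 + φ t w.2)‖ ≤ _
        rw [add_sub_add_comm]
        have := (norm_add_le _ _).trans (add_le_add (hf_lip t z.1 w.1) (hφ_lip t z.2 w.2))
        linarith
      · change ‖g t z.1 + ψ t z.2 - (g t w.1 + ψ t w.2)‖ ≤ _
        rw [add_sub_add_comm]
        have := (norm_add_le _ _).trans (add_le_add (hg_lip t z.1 w.1) (hψ_lip t z.2 w.2))
        linarith
    · have hf0 : f t 0 = 0 := norm_le_zero_iff.mp (by simpa using hf_bd t 0)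
      have hg0 : g t 0 = 0 := norm_le_zero_iff.mp (by simpa using hg_bd t 0)
      refine norm_prod_le_iff.mpr ⟨?_, ?_⟩
      · simpa [hf0] using hφ_bd t 0
      · simpa [hg0] using hψ_bd t 0
  -- The general condition 4KL < α with L = 2ω is exactly 8Kω/α < 1.
  have hsmall : 4 * K * (2 * ω) < α := by
    rw [div_lt_one hα] at hKω
    linarith
  have key := D.topologicallyConjugated_linear hlip hsmall
  have e : (fun t (z : X × Y) => (A t z.1 + f t z.1 + φ t z.2, B t z.2 + g t z.1 + ψ t z.2))
      = fun t z => (A t).prodMap (B t) z + (f t z.1 + φ t z.2, g t z.1 + ψ t z.2) := by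
    funext t z
    exact Prod.ext (add_assoc _ _ _) (add_assoc _ _ _)
  rw [e]
  exact key
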